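/- **Reduction of the Bessel constitutive equation.** Let $\nu>-1$. Let $\sigma,\varepsilon:\mathbb R\to\mathbb R$ be causal (zero for $t<0$) and $C^\infty$ on $[0,\infty)$, and write $f^{(n)}(0+)$ for one-sided derivatives at $0$. For $k\ge 0$ put $$p_k=\frac1{k!\,\Gamma(\nu+k+1)\,4^{k+\nu/2}},\qquad q_k=\frac1{k!\,\Gamma(\nu+k+3)\,4^{k+1+\nu/2}},$$ so that $I_\nu(\sqrt z)=\sum_k p_kz^{k+\nu/2}$ and $I_{\nu+2}(\sqrt z)=\sum_k q_kz^{k+1+\nu/2}$, where $I_\mu$ is the modified Bessel function of the first kind (principal branches). Let $D_*^\alpha$ be the Caputo derivative with starting point $0$ (for $\alpha<0$: the Riemann–Liouville integral of order $-\alpha$), and let $$P_\nu^{(N)}(D_*)\sigma=\sum_{k=0}^N p_kD_*^{k+\nu/2}\sigma,\qquad Q_\nu^{(N)}(D_*)\varepsilon=\sum_{k=0}^N q_kD_*^{k+1+\nu/2}\varepsilon,$$ with limits $P_\nu(D_*)\sigma$, $Q_\nu(D_*)\varepsilon$ as $N\to\infty$. Assume: * both sequences converge at almost every $t\ge0$,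 and there are $\alpha,\beta\in L^1([0,\infty))$ with $|P_\nu^{(N)}(D_*)\sigma|\le\alpha$ and $|Q_\nu^{(N)}(D_*)\varepsilon|\le\beta$ almost everywhere, for all $N\ge1$; * for every integer $k\ge1$ the following two series converge and have the same sum (this is the condition on the initial data): $$\sum_{n\ge\max(0,\,k-\lceil\nu/2\rceil)}p_n\,\sigma^{(\lceil\nu/2\rceil+n-k)}(0+)=\sum_{n\ge\max(0,\,k-\lceil\nu/2\rceil-1)}q_n\,\varepsilon^{(\lceil\nu/2\rceil+n+1-k)}(0+).$$ Then: 1. The Laplace transforms $\tilde\sigma(s),\tilde\varepsilon(s)$ converge absolutely for $\operatorname{Re}s>0$, and the infinite-order fractional equation $P_\nu(D_*)\sigma=Q_\nu(D_*)\varepsilon$ (a.e. on $[0,\infty)$) holds if and only if $$I_\nu(\sqrt s)\,\tilde\sigma(s)=I_{\nu+2}(\sqrt s)\,\tilde\varepsilon(s)\qquad\text{for all }s\text{ with }\operatorname{Re}s>0.\tag{L}$$ 2. $I_{\nu+2}(\sqrt s)\ne0$ for $\operatorname{Re}s>0$. If the fractional equation holds, $\sigma\not\equiv0$ on $[0,\infty)$,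 and $J$ is a creep compliance for $(\sigma,\varepsilon)$, i.e. $J$ is nonnegative, nondecreasing and locally absolutely continuous on $[0,\infty)$ with $\varepsilon(t)=J(0+)\sigma(t)+(\dot J*\sigma)(t)$ for $t\ge0$, then $$s\tilde J(s)=\frac{I_\nu(\sqrt s)}{I_{\nu+2}(\sqrt s)}$$ for every $s$ with $\operatorname{Re}s>0$ at which the Laplace integral of $J$ converges absolutely. 3. (L) is equivalent to the ordinary infinite-order equation $\overline P_\nu(D)\sigma=\overline Q_\nu(D)\varepsilon$, where $D=d/dt$ and $$\overline P_\nu(z)=\sum_{k\ge0}\frac{(z/4)^k}{k!\,\Gamma(\nu+k+1)},\qquad \overline Q_\nu(z)=\sum_{k\ge0}\frac{(z/4)^{k+1}}{k!\,\Gamma(\nu+k+3)}.$$ Precisely: (a) (L) holds if and only if, for every $w\in C_c^\infty(\mathbb R)$, the integrals over $(0,\infty)$ of $w$ against the partial sums of $\overline P_\nu(D)\sigma$ and of $\overline Q_\nu(D)\varepsilon$ both converge, to the same limit. (b) If $\nu\ge0$, both series converge at almost every $t\ge0$, and (L) holds if and only if $\overline P_\nu(D)\sigma(t)=\overline Q_\nu(D)\varepsilon(t)$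 for almost every $t\ge0$. (c) For any $\nu>-1$ the equivalence of (L) with the almost-everywhere equation also holds whenever the partial sums (of index $N\ge 1$) of both series converge almost everywhere and are dominated by locally integrable functions on $[0,\infty)$. -/

import Mathlib

open Filter Topology MeasureTheory Set
open scoped ContDiff Nat

noncomputable section

namespace BesselBody

/-- Lebesgue measure on the half-line of nonnegative times. -/
abbrev timeMeasure : Measure ℝ := volume.restrict (Ici 0)

/-- The class `𝓗^∞` of causal functions that are smooth on `[0, ∞)`. -/
structure IsHistory (f : ℝ → ℝ) : Prop where
  causal : ∀ t < 0, f t = 0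
  smooth : ContDiffOn ℝ ∞ f (Ici 0)

/-- The `n`-th (one-sided at `0`) derivative on `[0, ∞)`. For a smooth causal history its value
at `t = 0` is the limit `f⁽ⁿ⁾(0+)`. -/
def D (n : ℕ) (f : ℝ → ℝ) (t : ℝ) : ℝ := iteratedDerivWithin n f (Ici 0) t

/-- The Caputo derivative `D_*^α f (t)` with starting point `0`. With `m = max ⌈α⌉ 0` it is
`f⁽ᵐ⁾(t)` if `α = m`, and `Γ(m-α)⁻¹ ∫₀ᵗ (t-τ)^(m-α-1) f⁽ᵐ⁾(τ) dτ` otherwise. For `α < 0` this is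
the Riemann-Liouville fractional integral of order `-α`. -/
def caputo (α : ℝ) (f : ℝ → ℝ) (t : ℝ) : ℝ :=
  if α = (⌈α⌉₊ : ℝ) then D ⌈α⌉₊ f t
  else (Real.Gamma (⌈α⌉₊ - α))⁻¹ *
    ∫ τ in (0 : ℝ)..t, (t - τ) ^ ((⌈α⌉₊ : ℝ) - α - 1) * D ⌈α⌉₊ f τ

/-- `I_μ(z) = ∑ₖ (z/2)^(2k+μ) / (k! Γ(μ+k+1))`, principal branch of the power. -/
def besselI (μ : ℝ) (z : ℂ) : ℂ :=
  ∑' k : ℕ, (z / 2) ^ ((2 * k + μ : ℝ) : ℂ) / ((k ! : ℂ) * (Real.Gamma (μ + k + 1) : ℂ))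

/-- `I_μ(√s)` with the principal square root. -/
def besselISqrt (μ : ℝ) (s : ℂ) : ℂ := besselI μ s.sqrt

/-- The coefficient of `z^(k+ν/2)` in `P_ν(z) = I_ν(√z)`. -/
def p (ν : ℝ) (k : ℕ) : ℝ := 1 / (k ! * Real.Gamma (ν + k + 1) * 4 ^ ((k : ℝ) + ν / 2))

/-- The coefficient of `z^(k+1+ν/2)` in `Q_ν(z) = I_{ν+2}(√z)`. -/
def q (ν : ℝ) (k : ℕ) : ℝ := 1 / (k ! * Real.Gamma (ν + k + 3) * 4 ^ ((k : ℝ) + 1 + ν / 2))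

/-- The truncated operator `P_ν^{(N)}(D_*) f`. -/
def truncP (ν : ℝ) (f : ℝ → ℝ) (N : ℕ) (t : ℝ) : ℝ :=
  ∑ k ∈ Finset.range (N + 1), p ν k * caputo (k + ν / 2) f t

/-- The truncated operator `Q_ν^{(N)}(D_*) f`. -/
def truncQ (ν : ℝ) (f : ℝ → ℝ) (N : ℕ) (t : ℝ) : ℝ :=
  ∑ k ∈ Finset.range (N + 1), q ν k * caputo (k + 1 + ν / 2) f t

/-- The truncation of the ordinary operator `P̄_ν(D) f`, where
`P̄_ν(z) = ∑ₖ (z/4)^k / (k! Γ(ν+k+1))`. -/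
def truncPbar (ν : ℝ) (f : ℝ → ℝ) (N : ℕ) (t : ℝ) : ℝ :=
  ∑ k ∈ Finset.range (N + 1), 1 / (k ! * Real.Gamma (ν + k + 1) * 4 ^ k) * D k f t

/-- The truncation of the ordinary operator `Q̄_ν(D) f`, where
`Q̄_ν(z) = ∑ₖ (z/4)^(k+1) / (k! Γ(ν+k+3))`. -/
def truncQbar (ν : ℝ) (f : ℝ → ℝ) (N : ℕ) (t : ℝ) : ℝ :=
  ∑ k ∈ Finset.range (N + 1), 1 / (k ! * Real.Gamma (ν + k + 3) * 4 ^ (k + 1)) * D (k + 1) f t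

/-- A sequence of functions converges at almost every time `t ≥ 0`. -/
def AEConvergent (F : ℕ → ℝ → ℝ) : Prop :=
  ∀ᵐ t ∂timeMeasure, ∃ l : ℝ, Tendsto (fun N => F N t) atTop (𝓝 l)

/-- The pointwise limit of a sequence of functions (meaningful where the limit exists). The
infinite order operators are the limits of their truncations. -/
def limitOp (F : ℕ → ℝ → ℝ) (t : ℝ) : ℝ := limUnder atTop (fun N => F N t)

/-- All `F N`, `N ≥ 1`, are dominated by one function in `L¹([0, ∞))`. -/
def DominatedL1 (F : ℕ → ℝ → ℝ) : Prop :=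
  ∃ a : ℝ → ℝ, IntegrableOn a (Ici 0) ∧ ∀ N ≥ 1, ∀ᵐ t ∂timeMeasure, |F N t| ≤ a t

/-- All `F N`, `N ≥ 1`, are dominated by one locally integrable function on `[0, ∞)`. -/
def DominatedL1loc (F : ℕ → ℝ → ℝ) : Prop :=
  ∃ a : ℝ → ℝ, LocallyIntegrableOn a (Ici 0) ∧ ∀ N ≥ 1, ∀ᵐ t ∂timeMeasure, |F N t| ≤ a t

/-- Partial sums of the stress side of the initial condition with index `k`: the sum of
`p_n σ^(⌈ν/2⌉+n-k)(0+)` over those `n ≤ N` with `n ≥ k - ⌈ν/2⌉`, which is all `n ≤ N` if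
`k ≤ ⌈ν/2⌉`. This is the case distinction made by the two Heaviside factors. -/
def initP (ν : ℝ) (σ : ℝ → ℝ) (k N : ℕ) : ℝ :=
  ∑ n ∈ (Finset.range (N + 1)).filter (fun n : ℕ => (k : ℤ) ≤ ⌈ν / 2⌉ + n),
    p ν n * D (⌈ν / 2⌉ + n - k).toNat σ 0

/-- Partial sums of the strain side of the initial condition with index `k`: the sum of
`q_n ε^(⌈ν/2⌉+n+1-k)(0+)` over those `n ≤ N` with `n ≥ k - ⌈ν/2⌉ - 1`. -/
def initQ (ν : ℝ) (ε : ℝ → ℝ) (k N : ℕ) : ℝ :=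
  ∑ n ∈ (Finset.range (N + 1)).filter (fun n : ℕ => (k : ℤ) ≤ ⌈ν / 2⌉ + n + 1),
    q ν n * D (⌈ν / 2⌉ + n + 1 - k).toNat ε 0

/-- The condition on the initial data: for every `k ≥ 1` the two series converge and have the
same sum. -/
def InitialCondition (ν : ℝ) (σ ε : ℝ → ℝ) : Prop :=
  ∀ k : ℕ, 1 ≤ k → ∃ l : ℝ,
    Tendsto (initP ν σ k) atTop (𝓝 l) ∧ Tendsto (initQ ν ε k) atTop (𝓝 l)

/-- The Laplace integral of `f` converges absolutely at `s`. -/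
def LaplaceConvergent (f : ℝ → ℝ) (s : ℂ) : Prop :=
  IntegrableOn (fun t : ℝ => Complex.exp (-s * t) * (f t : ℂ)) (Ioi 0)

/-- The Laplace transform. -/
def laplace (f : ℝ → ℝ) (s : ℂ) : ℂ :=
  ∫ t in Ioi (0 : ℝ), Complex.exp (-s * t) * (f t : ℂ)

/-- `P_ν(D_*) σ = Q_ν(D_*) ε` at almost every `t ≥ 0`. -/
def FractionalEquation (ν : ℝ) (σ ε : ℝ → ℝ) : Prop :=
  ∀ᵐ t ∂timeMeasure, limitOp (truncP ν σ) t = limitOp (truncQ ν ε) t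

/-- `I_ν(√s) σ̃(s) = I_{ν+2}(√s) ε̃(s)` for `Re s > 0`. -/
def LaplaceEquation (ν : ℝ) (σ ε : ℝ → ℝ) : Prop :=
  ∀ s : ℂ, 0 < s.re →
    besselISqrt ν s * laplace σ s = besselISqrt (ν + 2) s * laplace ε s

/-- `P̄_ν(D) σ = Q̄_ν(D) ε` at almost every `t ≥ 0`. -/
def OrdinaryEquation (ν : ℝ) (σ ε : ℝ → ℝ) : Prop :=
  ∀ᵐ t ∂timeMeasure, limitOp (truncPbar ν σ) t = limitOp (truncQbar ν ε) t

/-- `P̄_ν(D) σ = Q̄_ν(D) ε` on `[0, ∞)` in the sense of distributions: tested against any smooth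
compactly supported function, both series converge, to the same value. -/
def WeakOrdinaryEquation (ν : ℝ) (σ ε : ℝ → ℝ) : Prop :=
  ∀ w : ℝ → ℝ, ContDiff ℝ ∞ w → HasCompactSupport w → ∃ l : ℝ,
    Tendsto (fun N => ∫ t in Ioi (0 : ℝ), truncPbar ν σ N t * w t) atTop (𝓝 l) ∧
    Tendsto (fun N => ∫ t in Ioi (0 : ℝ), truncQbar ν ε N t * w t) atTop (𝓝 l)

/-- `J` is a creep compliance relating the stress `σ` to the strain `ε`: it is nonnegative,
nondecreasing and locally absolutely continuous on `[0, ∞)`, and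
`ε(t) = J(0+) σ(t) + (J' * σ)(t)`. -/
structure IsCreepCompliance (J σ ε : ℝ → ℝ) : Prop where
  nonneg : ∀ t, 0 ≤ t → 0 ≤ J t
  mono : MonotoneOn J (Ici 0)
  absCont : ∀ T, 0 < T → AbsolutelyContinuousOnInterval J 0 T
  strain : ∀ t, 0 ≤ t → ε t = J 0 * σ t + ∫ τ in (0 : ℝ)..t, deriv J (t - τ) * σ τ

end BesselBody

end

/-! Put m = ⌈ν/2⌉ and θ = m - ν/2, which lies in [0, 1], and let J^μ be the Riemann-Liouville
integral, which multiplies Laplace transforms by s^(-μ). The Caputo derivative of order k + ν/2 is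
J^θ of the ordinary derivative of order m + k. Hence the transform of a truncated operator is s^(-θ)
times (s^m Σ p_k s^k σ̃(s) minus a power series in s whose coefficients are the truncated initial
sums); on the strain side m becomes m + 1 and p becomes q.

The analytic core is the passage N → ∞ (`FracDominated.laplace_limit`). On the left it is dominated
convergence. On the right the power series of initial sums needs a bound uniform in N, and the
domination supplies it: consecutive partial sums differ by one term, so the L¹ norm of J^θ F_(a+k)
is O(1/c_k), and transforms at s = 1 turn this into |F_m(0)| ≤ C / c_(m+1)
(`FracDominated.initial_le`). The factorial decay of the Bessel coefficients then makes the i-th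
initial sum O(1/(i-a)!) uniformly in N (`initialSum_bound`). In the limit the initial series of
stress and strain coincide, so they cancel in the difference, and s^(-θ) s^m = s^(ν/2) rebuilds the
Bessel functions. Injectivity of the Laplace transform gives the equivalence with (L)
(`fractional_iff_laplace`).

For the ordinary equation, integrating the fractional partial sums back by order m - θ = ν/2
recovers the ordinary ones up to finitely many power functions weighted by initial sums
(`FracDominated.rl_ord`). If ν ≥ 0 this is a genuine integral and dominated convergence survives it.
In general one more integration makes the order 1 + ν/2 > 0; moving it onto a test function gives
the weak statement. The power functions have the same limit on both sides, so the limits agree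
exactly when the fractional ones do.

The denominator does not vanish because of an energy identity along the ray through s for the Bessel
differential equation (`BesselCoeff.entire_ne_zero`). The compliance formula is (L) divided by σ̃,
whose zeros are isolated. -/

namespace BesselBody

/-! ### Elementary rules for the Laplace transform -/

/-- The Laplace integral converges absolutely in the open right half-plane. -/
def Transformable (f : ℝ → ℝ) : Prop := ∀ s : ℂ, 0 < s.re → LaplaceConvergent f s

theorem LaplaceConvergent.add {f g : ℝ → ℝ} {s : ℂ} (hf : LaplaceConvergent f s)
    (hg : LaplaceConvergent g s) : LaplaceConvergent (fun t => f t + g t) s := by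
  refine (Integrable.add hf hg).congr (Eventually.of_forall fun t => ?_)
  simp [mul_add]

theorem laplace_add {f g : ℝ → ℝ} {s : ℂ} (hf : LaplaceConvergent f s)
    (hg : LaplaceConvergent g s) :
    laplace (fun t => f t + g t) s = laplace f s + laplace g s := by
  rw [laplace, laplace, laplace, ← integral_add hf hg]
  simp [mul_add]

theorem LaplaceConvergent.const_mul {f : ℝ → ℝ} {s : ℂ} (hf : LaplaceConvergent f s) (c : ℝ) :
    LaplaceConvergent (fun t => c * f t) s := by
  refine (Integrable.const_mul hf (c : ℂ)).congr (Eventually.of_forall fun t => ?_)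
  simp only [Complex.ofReal_mul]; ring

theorem laplace_const_mul (f : ℝ → ℝ) (s : ℂ) (c : ℝ) :
    laplace (fun t => c * f t) s = c * laplace f s := by
  rw [laplace, laplace, ← integral_const_mul]
  congr 1 with t
  simp only [Complex.ofReal_mul]; ring

theorem LaplaceConvergent.sub {f g : ℝ → ℝ} {s : ℂ} (hf : LaplaceConvergent f s)
    (hg : LaplaceConvergent g s) : LaplaceConvergent (fun t => f t - g t) s := by
  refine (Integrable.sub hf hg).congr (Eventually.of_forall fun t => ?_)
  simp [mul_sub]

theorem laplace_sub {f g : ℝ → ℝ} {s : ℂ} (hf : LaplaceConvergent f s)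
    (hg : LaplaceConvergent g s) :
    laplace (fun t => f t - g t) s = laplace f s - laplace g s := by
  rw [laplace, laplace, laplace, ← integral_sub hf hg]
  simp [mul_sub]

theorem LaplaceConvergent.sum {f : ℕ → ℝ → ℝ} {s : ℂ} {S : Finset ℕ}
    (hf : ∀ k ∈ S, LaplaceConvergent (f k) s) : LaplaceConvergent (fun t => ∑ k ∈ S, f k t) s := by
  refine (integrable_finsetSum S hf).congr (Eventually.of_forall fun t => ?_)
  simp [Finset.mul_sum]

theorem laplace_sum {f : ℕ → ℝ → ℝ} {s : ℂ} {S : Finset ℕ}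
    (hf : ∀ k ∈ S, LaplaceConvergent (f k) s) :
    laplace (fun t => ∑ k ∈ S, f k t) s = ∑ k ∈ S, laplace (f k) s := by
  simp only [laplace]
  rw [← integral_finsetSum S hf]
  simp [Finset.mul_sum]

theorem LaplaceConvergent.congr {f g : ℝ → ℝ} {s : ℂ} (hf : LaplaceConvergent f s)
    (h : f =ᵐ[volume.restrict (Ioi 0)] g) : LaplaceConvergent g s := by
  refine Integrable.congr hf ?_
  filter_upwards [h] with t ht
  simp [ht]

theorem laplace_congr {f g : ℝ → ℝ} (h : f =ᵐ[volume.restrict (Ioi 0)] g) (s : ℂ) :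
    laplace f s = laplace g s := by
  refine integral_congr_ae ?_
  filter_upwards [h] with t ht
  simp [ht]

theorem LaplaceConvergent.mono {f : ℝ → ℝ} {s z : ℂ} (hf : LaplaceConvergent f s)
    (h : s.re ≤ z.re) : LaplaceConvergent f z := by
  have : IntegrableOn (fun t : ℝ => Complex.exp (-(z - s) * t) *
      (Complex.exp (-s * t) * (f t : ℂ))) (Ioi 0) := by
    refine Integrable.bdd_mul (c := 1) hf (by fun_prop) ?_
    filter_upwards [ae_restrict_mem measurableSet_Ioi] with t ht
    rw [Complex.norm_exp]
    simp only [Complex.mul_re, Complex.neg_re, Complex.sub_re, Complex.ofReal_re, Complex.ofReal_im,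
      mul_zero, sub_zero, Real.exp_le_one_iff]
    exact mul_nonpos_of_nonpos_of_nonneg (by linarith) (le_of_lt ht)
  refine this.congr (Eventually.of_forall fun t => ?_)
  simp only
  rw [← mul_assoc, ← Complex.exp_add]
  congr 2; ring

theorem laplaceConvergent_of_integrableOn {f : ℝ → ℝ} (hf : IntegrableOn f (Ioi 0)) {s : ℂ}
    (hs : 0 ≤ s.re) : LaplaceConvergent f s := by
  have : LaplaceConvergent f 0 := by
    simpa [LaplaceConvergent] using! hf.ofReal (𝕜 := ℂ)
  exact this.mono hs

theorem IntegrableOn.transformable {f : ℝ → ℝ} (hf : IntegrableOn f (Ioi 0)) : Transformable f :=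
  fun _ hs => laplaceConvergent_of_integrableOn hf hs.le

theorem LaplaceConvergent.integrableOn_real {f : ℝ → ℝ} {x : ℝ} (hf : LaplaceConvergent f x) :
    IntegrableOn (fun t => Real.exp (-x * t) * f t) (Ioi 0) := by
  refine (Integrable.re hf).congr (Eventually.of_forall fun t => ?_)
  simp only [← Complex.ofReal_neg, ← Complex.ofReal_mul, ← Complex.ofReal_exp]
  exact Complex.ofReal_re _

theorem LaplaceConvergent.intervalIntegrable {f : ℝ → ℝ} {s : ℂ} (hf : LaplaceConvergent f s)
    {T : ℝ} (hT : 0 ≤ T) : IntervalIntegrable f volume 0 T := by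
  rw [intervalIntegrable_iff_integrableOn_Ioc_of_le hT]
  have h1 : IntegrableOn (fun t : ℝ => Complex.exp (-s * t) * (f t : ℂ)) (Ioc 0 T) :=
    IntegrableOn.mono_set hf Ioc_subset_Ioi_self
  have h2 : IntegrableOn (fun t : ℝ => Complex.exp (s * t) * (Complex.exp (-s * t) * (f t : ℂ)))
      (Ioc 0 T) := by
    have := (intervalIntegrable_iff_integrableOn_Ioc_of_le hT).2 h1
    rw [← intervalIntegrable_iff_integrableOn_Ioc_of_le hT]
    exact this.continuousOn_mul (by fun_prop)
  refine (Integrable.re h2).congr (Eventually.of_forall fun t => ?_)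
  simp only
  rw [← mul_assoc, ← Complex.exp_add]
  simp

theorem norm_laplace_le {f : ℝ → ℝ} (hf : IntegrableOn f (Ioi 0)) {s : ℂ} (hs : 0 ≤ s.re) :
    ‖laplace f s‖ ≤ ∫ t in Ioi (0 : ℝ), |f t| := by
  refine norm_integral_le_of_norm_le hf.abs ?_
  filter_upwards [ae_restrict_mem measurableSet_Ioi] with t ht
  rw [norm_mul, Complex.norm_exp, Complex.norm_real, Real.norm_eq_abs]
  refine mul_le_of_le_one_left (abs_nonneg _) ?_
  simp only [Complex.mul_re, Complex.neg_re, Complex.ofReal_re, Complex.ofReal_im,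
      mul_zero, sub_zero, Real.exp_le_one_iff]
  exact mul_nonpos_of_nonpos_of_nonneg (by linarith) (le_of_lt ht)

/-! ### Causal convolution -/

/-- The causal convolution of two functions on `[0, ∞)`. -/
noncomputable def conv (f g : ℝ → ℝ) (t : ℝ) : ℝ := ∫ τ in (0 : ℝ)..t, f (t - τ) * g τ

theorem exp_mul_conv (f g : ℝ → ℝ) (s : ℂ) (t : ℝ) :
    Complex.exp (-s * t) * (conv f g t : ℂ) =
      ∫ τ in (0 : ℝ)..t, ContinuousLinearMap.mul ℝ ℂ (Complex.exp (-s * τ) * (g τ : ℂ))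
        (Complex.exp (-s * (t - τ : ℝ)) * (f (t - τ) : ℂ)) := by
  rw [conv, ← intervalIntegral.integral_ofReal, ← intervalIntegral.integral_const_mul]
  refine intervalIntegral.integral_congr fun τ _ => ?_
  simp only [ContinuousLinearMap.mul_apply', Complex.ofReal_mul]
  have : Complex.exp (-s * t) = Complex.exp (-s * τ) * Complex.exp (-s * (t - τ : ℝ)) := by
    rw [← Complex.exp_add]; congr 1; push_cast; ring
  rw [this]; ring

theorem LaplaceConvergent.conv {f g : ℝ → ℝ} {s : ℂ} (hf : LaplaceConvergent f s)
    (hg : LaplaceConvergent g s) : LaplaceConvergent (conv f g) s := by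
  have := (integrable_posConvolution hg hf (ContinuousLinearMap.mul ℝ ℂ)).integrableOn (s := Ioi 0)
  refine (integrableOn_congr_fun (fun t ht => ?_) measurableSet_Ioi).1 this
  simp only [posConvolution, indicator_of_mem ht]
  rw [exp_mul_conv]

theorem laplace_conv {f g : ℝ → ℝ} {s : ℂ} (hf : LaplaceConvergent f s)
    (hg : LaplaceConvergent g s) : laplace (conv f g) s = laplace f s * laplace g s := by
  have := integral_posConvolution hg hf (ContinuousLinearMap.mul ℝ ℂ)
  rw [mul_comm, laplace, laplace, laplace]
  rw [ContinuousLinearMap.mul_apply'] at this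
  rw [← this]
  refine setIntegral_congr_fun measurableSet_Ioi fun t _ => ?_
  simp only [exp_mul_conv]

/-! ### Analyticity and injectivity -/

theorem Transformable.differentiableOn_laplace {f : ℝ → ℝ} (hf : Transformable f) :
    DifferentiableOn ℂ (laplace f) {s | 0 < s.re} := by
  intro s hs
  apply DifferentiableAt.differentiableWithinAt
  have hs' : 0 < s.re := hs
  -- With x = Re s / 4, every z in the ball of radius Re s / 2 has Re z ≥ 2x; half of this decay
  -- absorbs the factor t through t ≤ x⁻¹ e^(xt).
  set x : ℝ := s.re / 4 with hx
  have hx0 : 0 < x := by positivity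
  have hbd : IntegrableOn (fun t : ℝ => x⁻¹ * (Real.exp (-x * t) * |f t|)) (Ioi 0) := by
    have := (hf (x : ℂ) (by simpa using hx0)).integrableOn_real.abs
    refine (this.const_mul x⁻¹).congr (Eventually.of_forall fun t => ?_)
    simp [abs_mul]
  have hmem : Metric.ball s (s.re / 2) ∈ 𝓝 s := Metric.ball_mem_nhds _ (by positivity)
  refine (hasDerivAt_integral_of_dominated_loc_of_deriv_le
    (F := fun z (t : ℝ) => Complex.exp (-z * t) * (f t : ℂ))
    (F' := fun z (t : ℝ) => (Complex.exp (-z * t) * (-t : ℂ)) * (f t : ℂ))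
    (bound := fun t => x⁻¹ * (Real.exp (-x * t) * |f t|)) hmem ?_ (hf s hs') ?_ ?_ hbd
    ?_).2.differentiableAt
  · have : ∀ᶠ z : ℂ in 𝓝 s, 0 < z.re :=
      (isOpen_lt continuous_const Complex.continuous_re).mem_nhds hs'
    filter_upwards [this] with z hz using (hf z hz).aestronglyMeasurable
  · have : AEStronglyMeasurable (fun t : ℝ => (-t : ℂ) * (Complex.exp (-s * t) * (f t : ℂ)))
        (volume.restrict (Ioi 0)) :=
      AEStronglyMeasurable.mul (by fun_prop) (hf s hs').aestronglyMeasurable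
    refine this.congr (Eventually.of_forall fun t => ?_)
    simp only; ring
  · filter_upwards [ae_restrict_mem measurableSet_Ioi] with t ht z hz
    have ht0 : 0 < t := ht
    have hz' : 2 * x ≤ z.re := by
      have h1 : |(z - s).re| ≤ ‖z - s‖ := Complex.abs_re_le_norm _
      have h2 : ‖z - s‖ < s.re / 2 := by simpa [dist_eq_norm] using hz
      have h3 := neg_le_of_abs_le (h1.trans h2.le)
      simp only [Complex.sub_re] at h3
      linarith
    rw [norm_mul, norm_mul, Complex.norm_exp, norm_neg, Complex.norm_real, Complex.norm_real,
      Real.norm_eq_abs, Real.norm_eq_abs, abs_of_pos ht0, ← mul_assoc]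
    refine mul_le_mul_of_nonneg_right ?_ (abs_nonneg _)
    simp only [Complex.mul_re, Complex.neg_re, Complex.ofReal_re, Complex.ofReal_im,
      mul_zero, sub_zero]
    have h4 : t ≤ x⁻¹ * Real.exp (x * t) := by
      have := Real.add_one_le_exp (x * t)
      rw [le_inv_mul_iff₀ hx0]; linarith
    calc Real.exp (-z.re * t) * t ≤ Real.exp (-(2 * x) * t) * (x⁻¹ * Real.exp (x * t)) := by
          gcongr
      _ = x⁻¹ * Real.exp (-x * t) := by
          rw [mul_left_comm, ← Real.exp_add]; congr 2; ring
  · refine Eventually.of_forall fun t z _ => ?_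
    refine HasDerivAt.mul_const ?_ _
    have : HasDerivAt (fun z : ℂ => -z * (t : ℂ)) (-t : ℂ) z := by
      simpa using ((hasDerivAt_id z).neg.mul_const (t : ℂ))
    exact this.cexp

/-- The positive and negative parts of f are densities of two finite measures. A vanishing Fourier
transform says that their characteristic functions agree, hence so do the measures and their
densities. -/
theorem integrable_ae_eq_zero_of_fourier {f : ℝ → ℝ} (hf : Integrable f)
    (h : ∀ y : ℝ, ∫ t : ℝ, Complex.exp (y * t * Complex.I) * (f t : ℂ) = 0) : f =ᵐ[volume] 0 := by
  set μp : Measure ℝ := volume.withDensity fun t => ENNReal.ofReal (f t)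
  set μn : Measure ℝ := volume.withDensity fun t => ENNReal.ofReal (-f t)
  have : IsFiniteMeasure μp := isFiniteMeasure_withDensity_ofReal hf.2
  have : IsFiniteMeasure μn := isFiniteMeasure_withDensity_ofReal hf.neg.2
  have hm : AEMeasurable f := hf.aemeasurable
  have key : ∀ g : ℝ → ℝ, Integrable g → ∀ y : ℝ,
      charFun (volume.withDensity fun t => ENNReal.ofReal (g t)) y =
        ∫ t : ℝ, Complex.exp (y * t * Complex.I) * ((max (g t) 0 : ℝ) : ℂ) := by
    intro g hg y
    rw [charFun_apply_real]
    have := integral_withDensity_eq_integral_smul₀ (μ := (volume : Measure ℝ))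
      (f := fun t => (g t).toNNReal) hg.aemeasurable.real_toNNReal
      (fun t : ℝ => Complex.exp (y * t * Complex.I))
    refine this.trans (integral_congr_ae (Eventually.of_forall fun t => ?_))
    simp only [NNReal.smul_def, Real.coe_toNNReal', Complex.real_smul, mul_comm]
  have hint : ∀ g : ℝ → ℝ, Integrable g → ∀ y : ℝ,
      Integrable fun t : ℝ => Complex.exp (y * t * Complex.I) * ((max (g t) 0 : ℝ) : ℂ) := by
    intro g hg y
    refine Integrable.bdd_mul (c := 1) hg.pos_part.ofReal (by fun_prop)
      (Eventually.of_forall fun t => ?_)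
    rw [← Complex.ofReal_mul, Complex.norm_exp_ofReal_mul_I]
  have heq : μp = μn := by
    refine Measure.ext_of_charFun (funext fun y => ?_)
    rw [key f hf, key (fun t => -f t) hf.neg, ← sub_eq_zero,
      ← integral_sub (hint f hf y) (hint (fun t => -f t) hf.neg y), ← h y]
    refine integral_congr_ae (Eventually.of_forall fun t => ?_)
    simp only
    rw [← mul_sub, ← Complex.ofReal_sub, max_zero_sub_max_neg_zero_eq_self]
  have := (withDensity_eq_iff hm.ennreal_ofReal hm.neg.ennreal_ofReal
    (hf.lintegral_lt_top).ne).1 heq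
  filter_upwards [this] with t ht
  simp only [Pi.zero_apply]
  have h2 := congrArg ENNReal.toReal ht
  simp only [Pi.neg_apply, ENNReal.toReal_ofReal'] at h2
  have := max_zero_sub_max_neg_zero_eq_self (f t)
  grind

/-- On the line Re s = x the Laplace transform is the Fourier transform of e^(-xt) f(t) extended by
zero, so one vertical line already determines f. -/
theorem ae_eq_zero_of_laplace_eq_zero {f : ℝ → ℝ} {x : ℝ} (hf : LaplaceConvergent f x)
    (h : ∀ s : ℂ, s.re = x → laplace f s = 0) : f =ᵐ[volume.restrict (Ioi 0)] 0 := by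
  have h1 := hf.integrableOn_real
  rw [← integrable_indicator_iff measurableSet_Ioi] at h1
  have h2 := integrable_ae_eq_zero_of_fourier h1 fun y => by
    have := h (x - y * Complex.I) (by simp)
    rw [laplace, ← integral_indicator measurableSet_Ioi] at this
    rw [← this]
    refine integral_congr_ae (Eventually.of_forall fun t => ?_)
    by_cases ht : t ∈ Ioi (0 : ℝ)
    · simp only [indicator_of_mem ht]
      rw [Complex.ofReal_mul, ← mul_assoc, Complex.ofReal_exp, ← Complex.exp_add]
      congr 2; push_cast; ring
    · simp [indicator_of_notMem ht]
  rw [EventuallyEq, ae_restrict_iff' measurableSet_Ioi]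
  filter_upwards [h2] with t ht hmem
  rw [indicator_of_mem hmem] at ht
  simpa using ht

theorem ae_eq_of_laplace_eq {f g : ℝ → ℝ} (hf : Transformable f) (hg : Transformable g)
    (h : ∀ s : ℂ, 0 < s.re → laplace f s = laplace g s) : f =ᵐ[volume.restrict (Ioi 0)] g := by
  have h1 : (fun t => f t - g t) =ᵐ[volume.restrict (Ioi 0)] 0 := by
    refine ae_eq_zero_of_laplace_eq_zero (x := 1)
      ((hf _ (by simp)).sub (hg _ (by simp))) fun s hs => ?_
    have hs : 0 < s.re := by rw [hs]; norm_num
    rw [laplace_sub (hf s hs) (hg s hs), h s hs, sub_self]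
  filter_upwards [h1] with t ht
  exact sub_eq_zero.1 ht

/-! ### Riemann-Liouville integrals -/

/-- The kernel `t^(μ-1)/Γ(μ)` of the Riemann-Liouville integral of order `μ`. -/
noncomputable def kern (μ t : ℝ) : ℝ := (Real.Gamma μ)⁻¹ * t ^ (μ - 1)

theorem kern_nonneg {μ t : ℝ} (hμ : 0 < μ) (ht : 0 ≤ t) : 0 ≤ kern μ t :=
  mul_nonneg (inv_nonneg.2 (Real.Gamma_pos_of_pos hμ).le) (Real.rpow_nonneg ht _)

theorem kern_one (t : ℝ) : kern 1 t = 1 := by simp [kern]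

theorem transformable_kern {μ : ℝ} (hμ : 0 < μ) : Transformable (kern μ) := by
  intro s hs
  have h : LaplaceConvergent (kern μ) (s.re : ℂ) := by
    have h1 : IntegrableOn (fun t : ℝ => Real.exp (-s.re * t) * kern μ t) (Ioi 0) := by
      have := integrableOn_rpow_mul_exp_neg_mul_rpow (p := 1) (s := μ - 1) (b := s.re)
        (by linarith) one_pos hs
      refine (this.const_mul (Real.Gamma μ)⁻¹).congr (Eventually.of_forall fun t => ?_)
      simp only [kern, Real.rpow_one]; ring
    refine (Integrable.ofReal (𝕜 := ℂ) h1).congr (Eventually.of_forall fun t => ?_)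
    simp
  exact h.mono (by simp)

theorem laplace_kern_ofReal {μ x : ℝ} (hμ : 0 < μ) (hx : 0 < x) :
    laplace (kern μ) x = (x : ℂ) ^ (-μ : ℂ) := by
  have h1 := Real.integral_rpow_mul_exp_neg_mul_Ioi hμ hx
  have h2 : laplace (kern μ) x = ((∫ t in Ioi (0 : ℝ),
      (Real.Gamma μ)⁻¹ * (t ^ (μ - 1) * Real.exp (-(x * t))) : ℝ) : ℂ) := by
    rw [laplace, ← integral_complex_ofReal]
    refine integral_congr_ae (Eventually.of_forall fun t => ?_)
    simp only [kern]
    push_cast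
    rw [neg_mul]; ring
  rw [h2, integral_const_mul, h1, mul_left_comm,
    inv_mul_cancel₀ (Real.Gamma_pos_of_pos hμ).ne', mul_one, one_div, Real.inv_rpow hx.le,
    ← Real.rpow_neg hx.le, Complex.ofReal_cpow hx.le]
  simp

/-- The Gamma integral settles real s > 0. Both sides are analytic in the half-plane and the reals
above 1 accumulate at 1, so the identity theorem does the rest. -/
theorem laplace_kern {μ : ℝ} (hμ : 0 < μ) {s : ℂ} (hs : 0 < s.re) :
    laplace (kern μ) s = s ^ (-μ : ℂ) := by
  have hopen : IsOpen {s : ℂ | 0 < s.re} := isOpen_lt continuous_const Complex.continuous_re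
  have hconv : Convex ℝ {s : ℂ | 0 < s.re} := convex_halfSpace_re_gt 0
  have hf := (transformable_kern hμ).differentiableOn_laplace.analyticOnNhd hopen
  have hg : AnalyticOnNhd ℂ (fun s : ℂ => s ^ (-μ : ℂ)) {s : ℂ | 0 < s.re} := by
    refine DifferentiableOn.analyticOnNhd (fun z hz => ?_) hopen
    exact (DifferentiableAt.cpow_const differentiableAt_id
      (Or.inl hz)).differentiableWithinAt
  refine hf.eqOn_of_preconnected_of_frequently_eq hg hconv.isPreconnected (z₀ := 1) (by simp) ?_ hs
  have ht : Tendsto (fun x : ℝ => (x : ℂ)) (𝓝[>] 1) (𝓝[≠] 1) := by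
    refine tendsto_nhdsWithin_iff.2 ⟨?_, ?_⟩
    · have : Tendsto (fun x : ℝ => (x : ℂ)) (𝓝 1) (𝓝 ((1 : ℝ) : ℂ)) :=
        Complex.continuous_ofReal.tendsto 1
      exact (by simpa using this : Tendsto (fun x : ℝ => (x : ℂ)) (𝓝 1) (𝓝 1)).mono_left
        nhdsWithin_le_nhds
    · filter_upwards [self_mem_nhdsWithin] with x hx
      have : (1 : ℝ) < x := hx
      simp only [mem_compl_iff, mem_singleton_iff]
      exact_mod_cast this.ne'
  refine ht.frequently (Eventually.frequently ?_)
  filter_upwards [self_mem_nhdsWithin] with x hx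
  exact laplace_kern_ofReal hμ (lt_trans one_pos hx)

/-- The Riemann-Liouville integral of order `μ ≥ 0`. -/
noncomputable def rl (μ : ℝ) (f : ℝ → ℝ) : ℝ → ℝ := if μ = 0 then f else conv (kern μ) f

theorem rl_zero (f : ℝ → ℝ) : rl 0 f = f := if_pos rfl

theorem rl_of_pos {μ : ℝ} (hμ : 0 < μ) (f : ℝ → ℝ) : rl μ f = conv (kern μ) f := if_neg hμ.ne'

theorem rl_one (f : ℝ → ℝ) (t : ℝ) : rl 1 f t = ∫ τ in (0 : ℝ)..t, f τ := by
  rw [rl_of_pos one_pos, conv]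
  simp [kern_one]

theorem LaplaceConvergent.rl {μ : ℝ} (hμ : 0 ≤ μ) {f : ℝ → ℝ} {s : ℂ} (hs : 0 < s.re)
    (hf : LaplaceConvergent f s) : LaplaceConvergent (rl μ f) s := by
  rcases hμ.eq_or_lt with rfl | hμ
  · rwa [rl_zero]
  · rw [rl_of_pos hμ]
    exact (transformable_kern hμ s hs).conv hf

theorem laplace_rl {μ : ℝ} (hμ : 0 ≤ μ) {f : ℝ → ℝ} {s : ℂ} (hs : 0 < s.re)
    (hf : LaplaceConvergent f s) : laplace (rl μ f) s = s ^ (-μ : ℂ) * laplace f s := by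
  rcases hμ.eq_or_lt with rfl | hμ
  · simp [rl_zero]
  · rw [rl_of_pos hμ, laplace_conv (transformable_kern hμ s hs) hf, laplace_kern hμ hs]

theorem Transformable.rl {μ : ℝ} (hμ : 0 ≤ μ) {f : ℝ → ℝ} (hf : Transformable f) :
    Transformable (rl μ f) := fun s hs => (hf s hs).rl hμ hs

/-! ### Localization -/

/-- Integrability on all bounded intervals `(0, T)`. -/
def LocInt (f : ℝ → ℝ) : Prop := ∀ T : ℝ, 0 ≤ T → IntervalIntegrable f volume 0 T

theorem Ioi_eq_iUnion_Ioc : Ioi (0 : ℝ) = ⋃ n : ℕ, Ioc (0 : ℝ) n := by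
  ext t
  simp only [mem_Ioi, mem_iUnion, mem_Ioc, exists_and_left]
  exact ⟨fun h => ⟨h, exists_nat_ge t⟩, fun h => h.1⟩

theorem ae_Ioi_of_forall_Ioc {p : ℝ → Prop}
    (h : ∀ T : ℝ, 0 ≤ T → ∀ᵐ t ∂volume.restrict (Ioc 0 T), p t) :
    ∀ᵐ t ∂volume.restrict (Ioi (0 : ℝ)), p t := by
  rw [Ioi_eq_iUnion_Ioc, ae_restrict_iUnion_iff]
  exact fun n => h n n.cast_nonneg

theorem aestronglyMeasurable_Ioi {f : ℝ → ℝ} (h : LocInt f) :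
    AEStronglyMeasurable f (volume.restrict (Ioi 0)) := by
  rw [Ioi_eq_iUnion_Ioc, aestronglyMeasurable_iUnion_iff]
  exact fun n => ((intervalIntegrable_iff_integrableOn_Ioc_of_le n.cast_nonneg).1
    (h n n.cast_nonneg)).aestronglyMeasurable

/-- On (0, T] a causal convolution sees only the values on (0, T]. Truncation therefore lets Laplace
arguments reach locally integrable functions of arbitrary growth. -/
theorem LocInt.truncate {f : ℝ → ℝ} (hf : LocInt f) {T : ℝ} (hT : 0 ≤ T) :
    Transformable (indicator (Ioc 0 T) f) := by
  refine IntegrableOn.transformable (Integrable.integrableOn ?_)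
  rw [integrable_indicator_iff measurableSet_Ioc]
  exact (intervalIntegrable_iff_integrableOn_Ioc_of_le hT).1 (hf T hT)

theorem Transformable.locInt {f : ℝ → ℝ} (hf : Transformable f) : LocInt f :=
  fun _ hT => (hf 1 (by simp)).intervalIntegrable hT

theorem conv_congr_ae {k f g : ℝ → ℝ} {T : ℝ} (h : f =ᵐ[volume.restrict (Ioc 0 T)] g) {t : ℝ}
    (ht : t ∈ Ioc 0 T) : conv k f t = conv k g t := by
  refine intervalIntegral.integral_congr_ae ?_
  rw [EventuallyEq, ae_restrict_iff' measurableSet_Ioc] at h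
  filter_upwards [h] with τ hτ hmem
  rw [uIoc_of_le ht.1.le] at hmem
  rw [hτ ⟨hmem.1, hmem.2.trans ht.2⟩]

theorem rl_congr_ae {μ : ℝ} {f g : ℝ → ℝ} {T : ℝ}
    (h : f =ᵐ[volume.restrict (Ioc 0 T)] g) :
    rl μ f =ᵐ[volume.restrict (Ioc 0 T)] rl μ g := by
  unfold rl
  split_ifs
  · exact h
  · filter_upwards [ae_restrict_mem measurableSet_Ioc] with t ht
    exact conv_congr_ae h ht

theorem rl_congr_ae_Ioi {μ : ℝ} {f g : ℝ → ℝ}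
    (h : f =ᵐ[volume.restrict (Ioi 0)] g) : rl μ f =ᵐ[volume.restrict (Ioi 0)] rl μ g :=
  ae_Ioi_of_forall_Ioc fun T _ => rl_congr_ae (T := T)
    (ae_restrict_of_ae_restrict_of_subset Ioc_subset_Ioi_self h)

theorem truncate_ae_eq (f : ℝ → ℝ) (T : ℝ) :
    indicator (Ioc 0 T) f =ᵐ[volume.restrict (Ioc 0 T)] f :=
  indicator_ae_eq_restrict measurableSet_Ioc

theorem LocInt.rl {μ : ℝ} (hμ : 0 ≤ μ) {f : ℝ → ℝ} (hf : LocInt f) : LocInt (rl μ f) := by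
  intro T hT
  have h1 := ((hf.truncate hT).rl hμ).locInt T hT
  rw [intervalIntegrable_iff_integrableOn_Ioc_of_le hT] at h1 ⊢
  exact h1.congr (rl_congr_ae (truncate_ae_eq f T))

/-- After truncation this is s^(-μ) s^(-κ) = s^(-(μ+κ)) and injectivity of the transform. -/
theorem rl_rl {μ κ : ℝ} (hμ : 0 ≤ μ) (hκ : 0 ≤ κ) {f : ℝ → ℝ} (hf : LocInt f) :
    rl μ (rl κ f) =ᵐ[volume.restrict (Ioi 0)] rl (μ + κ) f := by
  refine ae_Ioi_of_forall_Ioc fun T hT => ?_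
  have hT' := hf.truncate hT
  have h1 := rl_congr_ae (μ := μ) (rl_congr_ae (μ := κ) (truncate_ae_eq f T))
  have h2 := rl_congr_ae (μ := μ + κ) (truncate_ae_eq f T)
  have h3 : rl μ (rl κ (indicator (Ioc 0 T) f)) =ᵐ[volume.restrict (Ioi 0)]
      rl (μ + κ) (indicator (Ioc 0 T) f) := by
    refine ae_eq_of_laplace_eq ((hT'.rl hκ).rl hμ) (hT'.rl (add_nonneg hμ hκ)) fun s hs => ?_
    have hs0 : s ≠ 0 := fun h => by simp [h] at hs
    rw [laplace_rl hμ hs ((hT'.rl hκ) s hs), laplace_rl hκ hs (hT' s hs),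
      laplace_rl (add_nonneg hμ hκ) hs (hT' s hs), ← mul_assoc, ← Complex.cpow_add _ _ hs0]
    congr 2; push_cast; ring
  have h4 := ae_restrict_of_ae_restrict_of_subset (Ioc_subset_Ioi_self : Ioc 0 T ⊆ Ioi 0) h3
  exact EventuallyEq.trans h1.symm (EventuallyEq.trans h4 h2)

theorem rl_injective {μ : ℝ} (hμ : 0 ≤ μ) {f g : ℝ → ℝ} (hf : Transformable f)
    (hg : Transformable g) (h : rl μ f =ᵐ[volume.restrict (Ioi 0)] rl μ g) :
    f =ᵐ[volume.restrict (Ioi 0)] g := by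
  refine ae_eq_of_laplace_eq hf hg fun s hs => ?_
  have hs0 : s ≠ 0 := fun h => by simp [h] at hs
  have := laplace_congr h s
  rw [laplace_rl hμ hs (hf s hs), laplace_rl hμ hs (hg s hs)] at this
  exact mul_left_cancel₀ (by simp [Complex.cpow_eq_zero_iff, hs0]) this

/-! ### Dominated convergence for Riemann-Liouville integrals -/

/-- The weight e^(-t) makes both factors integrable on the half-line, where Fubini yields the
convolution almost everywhere. The weight is multiplicative, so for fixed t it is undone by the
constant e^t. -/
theorem ae_intervalIntegrable_conv {f g : ℝ → ℝ} (hf : Transformable f) (hg : Transformable g) :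
    ∀ᵐ t ∂volume.restrict (Ioi (0 : ℝ)),
      IntervalIntegrable (fun τ => f (t - τ) * g τ) volume 0 t := by
  have h1 := (hf (1 : ℝ) (by simp)).integrableOn_real
  have h2 := (hg (1 : ℝ) (by simp)).integrableOn_real
  rw [← integrable_indicator_iff measurableSet_Ioi] at h1 h2
  have h3 := h2.ae_convolution_exists (L := ContinuousLinearMap.mul ℝ ℝ) h1
  filter_upwards [ae_restrict_of_ae h3, ae_restrict_mem measurableSet_Ioi] with t ht ht0
  rw [intervalIntegrable_iff_integrableOn_Ioo_of_le (le_of_lt ht0)]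
  have h4 := (Integrable.integrableOn (s := Ioo 0 t) ht).const_mul (Real.exp t)
  refine (integrableOn_congr_fun (fun τ hτ => ?_) measurableSet_Ioo).1 h4
  have h5 : t - τ ∈ Ioi (0 : ℝ) := sub_pos.2 hτ.2
  have h6 : τ ∈ Ioi (0 : ℝ) := hτ.1
  simp only [ContinuousLinearMap.mul_apply', indicator_of_mem h5, indicator_of_mem h6]
  have : Real.exp t * (Real.exp (-1 * τ) * Real.exp (-1 * (t - τ))) = 1 := by
    rw [← Real.exp_add, ← Real.exp_add, Real.exp_eq_one_iff]; ring
  linear_combination (f (t - τ) * g τ) * this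

/-- Dominated convergence under the integral sign, with majorant `kern μ (t - τ) * α τ`, integrable
for almost every t. The new sequence is again dominated, by `rl μ α`. -/
theorem rl_tendsto {μ : ℝ} (hμ : 0 ≤ μ) {F : ℕ → ℝ → ℝ} {G α : ℝ → ℝ}
    (hα : IntegrableOn α (Ioi 0)) (hm : ∀ N, AEStronglyMeasurable (F N) (volume.restrict (Ioi 0)))
    (hdom : ∀ N ≥ 1, ∀ᵐ t ∂volume.restrict (Ioi 0), |F N t| ≤ α t)
    (hlim : ∀ᵐ t ∂volume.restrict (Ioi 0), Tendsto (fun N => F N t) atTop (𝓝 (G t))) :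
    ∀ᵐ t ∂volume.restrict (Ioi 0), Tendsto (fun N => rl μ (F N) t) atTop (𝓝 (rl μ G t)) ∧
      ∀ N ≥ 1, |rl μ (F N) t| ≤ rl μ α t := by
  have hdom' : ∀ᵐ t ∂volume.restrict (Ioi 0), ∀ N ≥ 1, |F N t| ≤ α t := by
    rw [ae_all_iff]; intro N
    by_cases hN : N ≥ 1
    · filter_upwards [hdom N hN] with t ht _ using ht
    · exact Eventually.of_forall fun t h => absurd h hN
  rcases hμ.eq_or_lt with rfl | hμ
  · simp only [rl_zero]
    filter_upwards [hdom', hlim] with t h1 h2 using ⟨h2, h1⟩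
  · simp only [rl_of_pos hμ]
    filter_upwards [ae_intervalIntegrable_conv (transformable_kern hμ)
      (IntegrableOn.transformable hα), ae_restrict_mem measurableSet_Ioi] with t ht ht0
    have ht0' : 0 < t := ht0
    have hsub : Ioc 0 t ⊆ Ioi (0 : ℝ) := Ioc_subset_Ioi_self
    have hb : ∀ N ≥ 1, ∀ᵐ τ, τ ∈ uIoc 0 t → ‖kern μ (t - τ) * F N τ‖ ≤ kern μ (t - τ) * α τ := by
      intro N hN
      have := (ae_restrict_iff' measurableSet_Ioi).1 hdom'
      filter_upwards [this] with τ hτ hmem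
      rw [uIoc_of_le ht0'.le] at hmem
      rw [norm_mul, Real.norm_eq_abs, Real.norm_eq_abs,
        abs_of_nonneg (kern_nonneg hμ (sub_nonneg.2 hmem.2))]
      exact mul_le_mul_of_nonneg_left (hτ (hsub hmem) N hN) (kern_nonneg hμ (sub_nonneg.2 hmem.2))
    have hkm : Measurable fun τ => kern μ (t - τ) := by unfold kern; fun_prop
    refine ⟨?_, fun N hN => ?_⟩
    · refine intervalIntegral.tendsto_integral_filter_of_dominated_convergence
        (fun τ => kern μ (t - τ) * α τ) (Eventually.of_forall fun N => ?_) ?_ ht ?_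
      · rw [uIoc_of_le ht0'.le]
        exact hkm.aestronglyMeasurable.mul ((hm N).mono_set hsub)
      · filter_upwards [eventually_ge_atTop 1] with N hN using hb N hN
      · have := (ae_restrict_iff' measurableSet_Ioi).1 hlim
        filter_upwards [this] with τ hτ hmem
        rw [uIoc_of_le ht0'.le] at hmem
        exact (hτ (hsub hmem)).const_mul _
    · have := intervalIntegral.norm_integral_le_of_norm_le (μ := volume)
        (f := fun τ => kern μ (t - τ) * F N τ) ht0'.le ?_ ht
      · simpa [conv] using this
      · filter_upwards [hb N hN] with τ hτ hmem
        exact hτ (by rwa [uIoc_of_le ht0'.le])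

/-! ### Towers of derivatives -/

/-- A sequence of continuous functions on `[0, ∞)`, each the derivative of the preceding one. -/
structure IsTower (F : ℕ → ℝ → ℝ) : Prop where
  cont : ∀ j, ContinuousOn (F j) (Ici 0)
  ftc : ∀ j t, 0 ≤ t → F j t = F j 0 + ∫ τ in (0 : ℝ)..t, F (j + 1) τ

theorem locInt_of_continuousOn {f : ℝ → ℝ} (hf : ContinuousOn f (Ici 0)) : LocInt f := by
  intro T hT
  refine ContinuousOn.intervalIntegrable (hf.mono ?_)
  rw [uIcc_of_le hT]
  exact Icc_subset_Ici_self

theorem IsTower.locInt {F : ℕ → ℝ → ℝ} (hF : IsTower F) (j : ℕ) : LocInt (F j) :=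
  locInt_of_continuousOn (hF.cont j)

theorem IsHistory.isTower {f : ℝ → ℝ} (hf : IsHistory f) : IsTower fun n => D n f := by
  have hc : ∀ n, ContinuousOn (D n f) (Ici 0) := fun n =>
    hf.smooth.continuousOn_iteratedDerivWithin (by exact_mod_cast le_top) (uniqueDiffOn_Ici 0)
  refine ⟨hc, fun n t ht => ?_⟩
  have hsub : Icc 0 t ⊆ Ici (0 : ℝ) := Icc_subset_Ici_self
  rw [intervalIntegral.integral_eq_sub_of_hasDerivAt_of_le ht ((hc n).mono hsub) (fun x hx => ?_)
    (locInt_of_continuousOn (hc (n + 1)) t ht)]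
  · ring
  · have hd := hf.smooth.differentiableOn_iteratedDerivWithin (m := n)
      (by exact_mod_cast WithTop.coe_lt_top _) (uniqueDiffOn_Ici 0) x (le_of_lt hx.1)
    have := hd.hasDerivWithinAt.hasDerivAt (Ici_mem_nhds hx.1)
    unfold D
    rwa [iteratedDerivWithin_succ]

theorem IsTower.shift {F : ℕ → ℝ → ℝ} (hF : IsTower F) (d : ℕ) : IsTower fun j => F (d + j) :=
  ⟨fun _ => hF.cont _, fun _ t ht => hF.ftc _ t ht⟩

theorem IsTower.combination {F : ℕ → ℝ → ℝ} (hF : IsTower F) (c : ℕ → ℝ) (S : Finset ℕ) :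
    IsTower fun j t => ∑ k ∈ S, c k * F (k + j) t := by
  refine ⟨fun j => continuousOn_finsetSum S fun k _ => (hF.cont _).const_smul (c k),
    fun j t ht => ?_⟩
  rw [intervalIntegral.integral_finsetSum
    fun k _ => ((hF.locInt (k + (j + 1))) t ht).const_mul (c k), ← Finset.sum_add_distrib]
  refine Finset.sum_congr rfl fun k _ => ?_
  rw [intervalIntegral.integral_const_mul, hF.ftc (k + j) t ht]
  ring_nf

/-- The fundamental theorem of calculus in terms of `kern` and `rl`, so that their transform rules
apply. -/
theorem IsTower.ae_eq {F : ℕ → ℝ → ℝ} (hF : IsTower F) (m : ℕ) :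
    F m =ᵐ[volume.restrict (Ioi 0)] fun t => F m 0 * kern 1 t + rl 1 (F (m + 1)) t := by
  filter_upwards [ae_restrict_mem measurableSet_Ioi] with t ht
  rw [rl_one, kern_one, mul_one]
  exact hF.ftc m t (le_of_lt ht)

theorem IsTower.transformable_pred {F : ℕ → ℝ → ℝ} (hF : IsTower F) {m : ℕ}
    (h : Transformable (rl 1 (F (m + 1)))) : Transformable (F m) := fun s hs =>
  (((transformable_kern one_pos s hs).const_mul _).add (h s hs)).congr (hF.ae_eq m).symm

theorem IsTower.laplace_succ {F : ℕ → ℝ → ℝ} (hF : IsTower F) {m : ℕ}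
    (h : Transformable (F (m + 1))) {s : ℂ} (hs : 0 < s.re) :
    laplace (F (m + 1)) s = s * laplace (F m) s - F m 0 := by
  have hs0 : s ≠ 0 := fun h => by simp [h] at hs
  rw [laplace_congr (hF.ae_eq m) s, laplace_add ((transformable_kern one_pos s hs).const_mul _)
    (h.rl zero_le_one s hs), laplace_const_mul, laplace_kern one_pos hs,
    laplace_rl zero_le_one hs (h s hs)]
  simp only [Complex.ofReal_one, Complex.cpow_neg_one]
  field_simp
  ring

theorem IsTower.laplace_eq {F : ℕ → ℝ → ℝ} (hF : IsTower F) (h : ∀ m, Transformable (F m))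
    {s : ℂ} (hs : 0 < s.re) (m : ℕ) :
    laplace (F m) s = s ^ m * laplace (F 0) s -
      ∑ j ∈ Finset.range m, s ^ (m - 1 - j) * (F j 0 : ℂ) := by
  induction m with
  | zero => simp
  | succ m ih =>
    rw [hF.laplace_succ (h (m + 1)) hs, ih, Finset.sum_range_succ, mul_sub, Finset.mul_sum]
    have : ∑ i ∈ Finset.range m, s * (s ^ (m - 1 - i) * (F i 0 : ℂ)) =
        ∑ i ∈ Finset.range m, s ^ (m + 1 - 1 - i) * (F i 0 : ℂ) := by
      refine Finset.sum_congr rfl fun i hi => ?_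
      have : m + 1 - 1 - i = (m - 1 - i) + 1 := by have := Finset.mem_range.1 hi; omega
      rw [this, pow_succ]; ring
    rw [this]
    simp only [add_tsub_cancel_right, tsub_self, pow_zero, pow_succ]
    ring

/-! ### Coefficients of Bessel type -/

/-- A multiple of the sequence `1 / (4^k k! Γ(ρ+k+1))`. -/
structure BesselCoeff (ρ : ℝ) (c : ℕ → ℝ) : Prop where
  gt : -1 < ρ
  pos : ∀ k, 0 < c k
  recurrence : ∀ k, c k = c (k + 1) * (4 * (k + 1) * (ρ + k + 1))

/-- The factor 4(n+1)(ρ+n+1) is at least 1 once n ≥ 1; for n = 0 it can be small when ρ is near -1.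
-/
theorem BesselCoeff.succ_le {ρ : ℝ} {c : ℕ → ℝ} (hc : BesselCoeff ρ c) {n : ℕ} (hn : 1 ≤ n) :
    c (n + 1) ≤ c n := by
  have h1 : (1 : ℝ) ≤ n := by exact_mod_cast hn
  have := hc.gt
  have := hc.pos (n + 1)
  rw [hc.recurrence n]
  exact le_mul_of_one_le_right this.le (by nlinarith)

theorem BesselCoeff.anti {ρ : ℝ} {c : ℕ → ℝ} (hc : BesselCoeff ρ c) {m n : ℕ} (hm : 1 ≤ m)
    (hn : m ≤ n) : c n ≤ c m := by
  induction n, hn using Nat.le_induction with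
  | base => exact le_rfl
  | succ n hmn ih => exact (hc.succ_le (hm.trans hmn)).trans ih

/-- The first two steps of the recurrence from l contribute at least 2(l+1)², and each later one at
least the next factor of j!. The square makes sums over l converge, while the factorial beats powers
of s. -/
theorem BesselCoeff.decay {ρ : ℝ} {c : ℕ → ℝ} (hc : BesselCoeff ρ c) {l j : ℕ} (hl : 1 ≤ l)
    (hj : 2 ≤ j) : c (l + j) * (j ! * ((l : ℝ) + 1) ^ 2) ≤ c l := by
  have hl1 : (1 : ℝ) ≤ l := by exact_mod_cast hl
  have hρ := hc.gt
  induction j, hj using Nat.le_induction with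
  | base =>
    have h := hc.pos (l + 2)
    rw [hc.recurrence l, hc.recurrence (l + 1), mul_assoc, show l + 1 + 1 = l + 2 from rfl]
    refine mul_le_mul_of_nonneg_left ?_ h.le
    push_cast
    have e1 : (l : ℝ) + 1 ≤ 4 * (l + 1 + 1) * (ρ + (l + 1) + 1) := by nlinarith
    have e2 : 2 * ((l : ℝ) + 1) ≤ 4 * (l + 1) * (ρ + l + 1) := by nlinarith
    have := mul_le_mul e1 e2 (by positivity) (by nlinarith)
    simp only [Nat.factorial]; push_cast
    linarith
  | succ j hj ih =>
    refine le_trans ?_ ih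
    have h := hc.pos (l + (j + 1))
    have hj0 : (0 : ℝ) ≤ j := j.cast_nonneg
    have e : ((j : ℝ) + 1) ≤ 4 * ((l + j : ℕ) + 1) * (ρ + (l + j : ℕ) + 1) := by
      push_cast; nlinarith
    rw [hc.recurrence (l + j), Nat.factorial_succ, mul_assoc (c (l + j + 1))]
    refine mul_le_mul_of_nonneg_left ?_ h.le
    push_cast at e ⊢
    rw [mul_assoc]
    exact mul_le_mul_of_nonneg_right e (by positivity)

theorem BesselCoeff.summable {ρ : ℝ} {c : ℕ → ℝ} (hc : BesselCoeff ρ c) (r : ℝ) :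
    Summable fun k => c k * r ^ k := by
  rw [← summable_nat_add_iff 3]
  refine Summable.of_norm_bounded (g := fun j => |c 1 * r| * (|r| ^ (j + 2) / (j + 2)!))
    (Summable.mul_left _ ?_) fun j => ?_
  · exact (summable_nat_add_iff 2).2 (Real.summable_pow_div_factorial |r|)
  · have := hc.decay (l := 1) (j := j + 2) le_rfl (by omega)
    have h2 := hc.pos (1 + (j + 2))
    have h1 := hc.pos 1
    rw [norm_mul, norm_pow, Real.norm_eq_abs, Real.norm_eq_abs,
      show j + 3 = 1 + (j + 2) by ring, abs_of_pos h2, pow_add, abs_mul,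
      abs_of_pos h1]
    have h3 : c (1 + (j + 2)) ≤ c 1 / (j + 2)! := by
      rw [le_div_iff₀ (by positivity)]
      refine le_trans (mul_le_mul_of_nonneg_left ?_ h2.le) this
      refine le_mul_of_one_le_right (by positivity) (by norm_num)
    calc c (1 + (j + 2)) * (|r| ^ 1 * |r| ^ (j + 2)) ≤
        c 1 / (j + 2)! * (|r| ^ 1 * |r| ^ (j + 2)) := by gcongr
      _ = _ := by ring

theorem BesselCoeff.summable_complex {ρ : ℝ} {c : ℕ → ℝ} (hc : BesselCoeff ρ c) (s : ℂ) :
    Summable fun k => (c k : ℂ) * s ^ k := by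
  refine Summable.of_norm ?_
  refine (hc.summable ‖s‖).congr fun k => ?_
  rw [norm_mul, norm_pow, Complex.norm_real, Real.norm_eq_abs, abs_of_pos (hc.pos k)]

/-! ### Fractional operators of infinite order -/

/-- The partial sums of `∑ₖ cₖ J^θ F_(a+k)`. -/
noncomputable def frac (c : ℕ → ℝ) (θ : ℝ) (a : ℕ) (F : ℕ → ℝ → ℝ) (N : ℕ) (t : ℝ) : ℝ :=
  ∑ k ∈ Finset.range (N + 1), c k * rl θ (F (a + k)) t

/-- The partial sums of the initial data. -/
noncomputable def initialSum (c : ℕ → ℝ) (a : ℕ) (F : ℕ → ℝ → ℝ) (i N : ℕ) : ℝ :=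
  ∑ n ∈ (Finset.range (N + 1)).filter (fun n => i ≤ a + n), c n * F (a + n - i) 0

/-- The partial sums of a fractional operator of infinite order are dominated by an integrable
function. -/
structure FracDominated (ρ : ℝ) (c : ℕ → ℝ) (θ : ℝ) (a : ℕ) (F : ℕ → ℝ → ℝ) (α : ℝ → ℝ) :
    Prop where
  coeff : BesselCoeff ρ c
  nonneg : 0 ≤ θ
  le_one : θ ≤ 1
  tower : IsTower F
  integrable : IntegrableOn α (Ioi 0)
  bound : ∀ N ≥ 1, ∀ᵐ t ∂volume.restrict (Ioi 0), |frac c θ a F N t| ≤ α t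

section
variable {ρ θ : ℝ} {c : ℕ → ℝ} {a : ℕ} {F : ℕ → ℝ → ℝ} {α : ℝ → ℝ}

/-- The k-th term is the difference of the partial sums of index k and k - 1. Domination starts at
index 1, hence k ≥ 2. -/
theorem FracDominated.abs_term_le (h : FracDominated ρ c θ a F α) {k : ℕ} (hk : 2 ≤ k) :
    ∀ᵐ t ∂volume.restrict (Ioi 0), |rl θ (F (a + k)) t| ≤ 2 / c k * α t := by
  obtain ⟨n, rfl⟩ : ∃ n, k = n + 1 := ⟨k - 1, by omega⟩
  filter_upwards [h.bound n (by omega), h.bound (n + 1) (by omega)] with t h1 h2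
  have hc := h.coeff.pos (n + 1)
  rw [frac, Finset.sum_range_succ] at h2
  unfold frac at h1
  rw [div_mul_eq_mul_div, le_div_iff₀ hc, mul_comm]
  nth_rw 1 [← abs_of_pos hc]
  rw [← abs_mul]
  rw [abs_le] at *
  constructor <;> linarith [h1.1, h1.2, h2.1, h2.2]

theorem FracDominated.aestronglyMeasurable (h : FracDominated ρ c θ a F α) (m : ℕ) :
    AEStronglyMeasurable (rl θ (F m)) (volume.restrict (Ioi 0)) :=
  aestronglyMeasurable_Ioi ((h.tower.locInt m).rl h.nonneg)

theorem FracDominated.integrable_term (h : FracDominated ρ c θ a F α) {k : ℕ} (hk : 2 ≤ k) :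
    IntegrableOn (rl θ (F (a + k))) (Ioi 0) :=
  Integrable.mono' (h.integrable.const_mul (2 / c k)) (h.aestronglyMeasurable _)
    (h.abs_term_le hk)

theorem FracDominated.integral_term_le (h : FracDominated ρ c θ a F α) {k : ℕ} (hk : 2 ≤ k) :
    ∫ t in Ioi 0, |rl θ (F (a + k)) t| ≤ 2 / c k * ∫ t in Ioi 0, α t := by
  rw [← integral_const_mul]
  exact integral_mono_ae (h.integrable_term hk).abs (h.integrable.const_mul _) (h.abs_term_le hk)

/-- For k ≥ 2 the function J^θ F_(a+k) is integrable, and J^(1-θ) J^θ = J^1. So J^1 F_(a+k) is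
transformable, which gives F_(a+k-1) by the fundamental theorem of calculus; lower members follow by
descending one integration at a time. -/
theorem FracDominated.transformable (h : FracDominated ρ c θ a F α) (m : ℕ) :
    Transformable (F m) := by
  have h1 : ∀ k, 2 ≤ k → Transformable (rl 1 (F (a + k))) := fun k hk s hs => by
    have := rl_rl (sub_nonneg.2 h.le_one) h.nonneg (h.tower.locInt (a + k))
    rw [sub_add_cancel] at this
    exact ((IntegrableOn.transformable (h.integrable_term hk)).rl
      (sub_nonneg.2 h.le_one) s hs).congr this
  have h3 : ∀ m, a + 1 ≤ m → Transformable (F m) := fun m hm => by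
    refine h.tower.transformable_pred ?_
    have := h1 (m + 1 - a) (by omega)
    rwa [show a + (m + 1 - a) = m + 1 by omega] at this
  have h4 : ∀ n m, m + n = a + 1 → Transformable (F m) := by
    intro n
    induction n with
    | zero => intro m hm; exact h3 m (by omega)
    | succ n ih =>
      intro m hm
      exact h.tower.transformable_pred ((ih (m + 1) (by omega)).rl zero_le_one)
  rcases le_total (a + 1) m with hm | hm
  · exact h3 m hm
  · exact h4 (a + 1 - m) m (by omega)

/-- The rule for the transform of a derivative expresses F_m(0) by the transforms of F_m and
F_(m+1). At s = 1 the factor s^(-θ) is 1, so these are the transforms of J^θ F_m and J^θ F_(m+1),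
bounded by L¹ norms. -/
theorem FracDominated.initial_le (h : FracDominated ρ c θ a F α) :
    ∃ C, 0 ≤ C ∧ ∀ m, |F m 0| ≤ C / c (m + 1) := by
  set A := ∫ t in Ioi 0, α t
  have hA : 0 ≤ A := by
    refine integral_nonneg_of_ae ?_
    filter_upwards [h.bound 1 le_rfl] with t ht using (abs_nonneg _).trans ht
  have hpos := h.coeff.pos
  -- The finitely many m < a + 2, to which the L¹ bounds do not apply, are absorbed in this
  -- constant.
  set C₀ := ∑ m ∈ Finset.range (a + 2), |F m 0| * c (m + 1)
  have hC₀ : 0 ≤ C₀ := Finset.sum_nonneg fun m _ => mul_nonneg (abs_nonneg _) (hpos _).le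
  refine ⟨4 * A + C₀, by positivity, fun m => ?_⟩
  rw [le_div_iff₀ (hpos _)]
  rcases lt_or_ge m (a + 2) with hm | hm
  · have := Finset.single_le_sum (f := fun m => |F m 0| * c (m + 1))
      (fun m _ => mul_nonneg (abs_nonneg _) (hpos _).le) (Finset.mem_range.2 hm)
    linarith
  · obtain ⟨k, hk, rfl⟩ : ∃ k, 2 ≤ k ∧ m = a + k := ⟨m - a, by omega, by omega⟩
    have h1 : (0 : ℝ) < (1 : ℂ).re := by simp
    have e := h.tower.laplace_succ (m := a + k) (h.transformable _) h1
    have e1 := laplace_rl h.nonneg h1 (h.transformable (a + k) 1 h1)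
    have e2 := laplace_rl h.nonneg h1 (h.transformable (a + k + 1) 1 h1)
    rw [Complex.one_cpow, one_mul] at e1 e2
    rw [← e1, ← e2, one_mul] at e
    have e3 : (F (a + k) 0 : ℂ) = laplace (rl θ (F (a + k))) 1 - laplace (rl θ (F (a + k + 1))) 1 :=
      by rw [e]; ring
    have b1 := (norm_laplace_le (h.integrable_term hk) h1.le).trans (h.integral_term_le hk)
    have b2 := (norm_laplace_le (h.integrable_term (k := k + 1) (by omega)) h1.le).trans
      (h.integral_term_le (by omega))
    have b3 : |F (a + k) 0| ≤ 2 / c k * A + 2 / c (k + 1) * A := by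
      rw [← Real.norm_eq_abs, ← Complex.norm_real, e3]
      exact (norm_sub_le _ _).trans (add_le_add b1 b2)
    have c1 := h.coeff.anti (m := k) (n := a + k + 1) (by omega) (by omega)
    have c2 := h.coeff.anti (m := k + 1) (n := a + k + 1) (by omega) (by omega)
    calc |F (a + k) 0| * c (a + k + 1) ≤ (2 / c k * A + 2 / c (k + 1) * A) * c (a + k + 1) :=
          mul_le_mul_of_nonneg_right b3 (hpos _).le
      _ = 2 * A * (c (a + k + 1) / c k) + 2 * A * (c (a + k + 1) / c (k + 1)) := by ring
      _ ≤ 2 * A * 1 + 2 * A * 1 := by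
          gcongr
          · exact (div_le_one (hpos _)).2 c1
          · exact (div_le_one (hpos _)).2 c2
      _ ≤ 4 * A + C₀ := by linarith

/-- With j = i - a and n = j + 1 + l, the summand is at most C c_(l+1+j) / c_(l+1), and
`BesselCoeff.decay` bounds this by C / (j! (l+1)²), independently of N. -/
theorem initialSum_bound (hc : BesselCoeff ρ c) {C : ℝ} (hC : 0 ≤ C)
    (hF : ∀ m, |F m 0| ≤ C / c (m + 1)) {i : ℕ} (hi : a + 2 ≤ i) (N : ℕ) :
    |initialSum c a F (i + 1) N| ≤ C * (∑' l : ℕ, 1 / ((l : ℝ) + 1) ^ 2) / (i - a)! := by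
  obtain ⟨j, hj, rfl⟩ : ∃ j, 2 ≤ j ∧ i = a + j := ⟨i - a, by omega, by omega⟩
  have hsum : Summable fun l : ℕ => 1 / ((l : ℝ) + 1) ^ 2 := by
    have := (summable_nat_add_iff 1).2 (Real.summable_one_div_nat_pow.2 (one_lt_two))
    simpa using this
  have hset : (Finset.range (N + 1)).filter (fun n => a + j + 1 ≤ a + n) =
      Finset.Ico (j + 1) (N + 1) := by
    ext n; simp only [Finset.mem_filter, Finset.mem_range, Finset.mem_Ico]; omega
  rw [initialSum, hset, Finset.sum_Ico_eq_sum_range, add_tsub_cancel_left]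
  have hterm : ∀ l, |c (j + 1 + l) * F (a + (j + 1 + l) - (a + j + 1)) 0| ≤
      C / j ! * (1 / ((l : ℝ) + 1) ^ 2) := by
    intro l
    rw [show a + (j + 1 + l) - (a + j + 1) = l by omega, abs_mul, abs_of_pos (hc.pos _)]
    have hd := hc.decay (l := l + 1) (j := j) (by omega) hj
    rw [show l + 1 + j = j + 1 + l by ring] at hd
    have h1 := hc.pos (j + 1 + l)
    have h2 := hc.pos (l + 1)
    have h3 : c (j + 1 + l) / c (l + 1) ≤ 1 / (j ! * ((l : ℝ) + 1) ^ 2) := by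
      rw [div_le_div_iff₀ h2 (by positivity), one_mul]
      refine le_trans ?_ hd
      push_cast
      gcongr
      linarith
    calc c (j + 1 + l) * |F l 0| ≤ c (j + 1 + l) * (C / c (l + 1)) := by gcongr; exact hF l
      _ = C * (c (j + 1 + l) / c (l + 1)) := by ring
      _ ≤ C * (1 / (j ! * ((l : ℝ) + 1) ^ 2)) := by gcongr
      _ = _ := by field_simp
  refine (Finset.abs_sum_le_sum_abs _ _).trans ((Finset.sum_le_sum fun l _ => hterm l).trans ?_)
  rw [← Finset.mul_sum, mul_div_right_comm]
  gcongr
  exact hsum.sum_le_tsum _ fun l _ => by positivity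

/-- The initial values produced by all the derivatives are regrouped by the power i = a + k - 1 - j
of s. The series is finite because the initial sums vanish for i ≥ a + N. -/
theorem initialSum_tsum (c : ℕ → ℝ) (a : ℕ) (F : ℕ → ℝ → ℝ) (N : ℕ) (s : ℂ) :
    ∑' i : ℕ, s ^ i * (initialSum c a F (i + 1) N : ℂ) =
      ∑ k ∈ Finset.range (N + 1), (c k : ℂ) *
        ∑ j ∈ Finset.range (a + k), s ^ (a + k - 1 - j) * (F j 0 : ℂ) := by
  rw [tsum_eq_sum (s := Finset.range (a + N))]
  · simp only [initialSum, Finset.sum_filter]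
    push_cast
    simp only [Finset.mul_sum]
    rw [Finset.sum_comm]
    refine Finset.sum_congr rfl fun n hn => ?_
    have hn' : n ≤ N := Nat.lt_succ_iff.1 (Finset.mem_range.1 hn)
    have hset : Finset.range (a + n) = (Finset.range (a + N)).filter (fun i => i + 1 ≤ a + n) := by
      ext i; simp only [Finset.mem_filter, Finset.mem_range]; omega
    rw [← Finset.sum_range_reflect (n := a + n), hset, Finset.sum_filter]
    refine Finset.sum_congr rfl fun i _ => ?_
    split_ifs with hi
    · rw [show a + n - 1 - (a + n - 1 - i) = i by omega,
        show a + n - 1 - i = a + n - (i + 1) by omega]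
      push_cast; ring
    · simp
  · intro i hi
    have : (Finset.range (N + 1)).filter (fun n => i + 1 ≤ a + n) = ∅ := by
      refine Finset.filter_eq_empty_iff.2 fun n hn => ?_
      rw [Finset.mem_range] at hi hn
      omega
    rw [initialSum, this]
    simp

/-- Dominated convergence for series. The factorial bound covers i ≥ a + 2; for the finitely many
smaller i, boundedness of a convergent sequence is enough. -/
theorem FracDominated.tendsto_initialSum (h : FracDominated ρ c θ a F α) {l : ℕ → ℝ}
    (hl : ∀ i, Tendsto (initialSum c a F (i + 1)) atTop (𝓝 (l i))) (s : ℂ) :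
    Tendsto (fun N => ∑' i : ℕ, s ^ i * (initialSum c a F (i + 1) N : ℂ)) atTop
      (𝓝 (∑' i : ℕ, s ^ i * (l i : ℂ))) := by
  obtain ⟨C, hC, hF⟩ := h.initial_le
  have hb : ∀ i, ∃ M, ∀ N, |initialSum c a F (i + 1) N| ≤ M := fun i => by
    obtain ⟨M, hM⟩ := (hl i).norm.bddAbove_range
    exact ⟨M, fun N => hM ⟨N, rfl⟩⟩
  choose M hM using hb
  set K := C * (∑' l : ℕ, 1 / ((l : ℝ) + 1) ^ 2)
  refine tendsto_tsum_of_dominated_convergence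
    (bound := fun i => ‖s‖ ^ i * if i < a + 2 then M i else K / (i - a)!) ?_
    (fun i => ((Complex.continuous_ofReal.tendsto _).comp (hl i)).const_mul _)
    (Eventually.of_forall fun N i => ?_)
  · rw [← summable_nat_add_iff (a + 2)]
    have := ((summable_nat_add_iff 2).2 (Real.summable_pow_div_factorial ‖s‖)).mul_left
      (K * ‖s‖ ^ a)
    refine this.congr fun i => ?_
    rw [if_neg (by omega), show i + (a + 2) - a = i + 2 by omega]
    ring
  · rw [norm_mul, norm_pow, Complex.norm_real, Real.norm_eq_abs]
    refine mul_le_mul_of_nonneg_left ?_ (by positivity)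
    split_ifs with hi
    · exact hM i N
    · exact initialSum_bound h.coeff hC hF (by omega) N

theorem FracDominated.transformable_rl (h : FracDominated ρ c θ a F α) (m : ℕ) :
    Transformable (rl θ (F m)) := (h.transformable m).rl h.nonneg

theorem FracDominated.transformable_frac (h : FracDominated ρ c θ a F α) (N : ℕ) :
    Transformable (frac c θ a F N) := fun s hs =>
  LaplaceConvergent.sum fun k _ => (h.transformable_rl (a + k) s hs).const_mul (c k)

theorem FracDominated.aestronglyMeasurable_frac (h : FracDominated ρ c θ a F α) (N : ℕ) :
    AEStronglyMeasurable (frac c θ a F N) (volume.restrict (Ioi 0)) :=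
  aestronglyMeasurable_Ioi (h.transformable_frac N).locInt

theorem FracDominated.laplace_frac (h : FracDominated ρ c θ a F α) (N : ℕ) {s : ℂ}
    (hs : 0 < s.re) : laplace (frac c θ a F N) s = s ^ (-θ : ℂ) *
      (s ^ a * (∑ k ∈ Finset.range (N + 1), (c k : ℂ) * s ^ k) * laplace (F 0) s -
        ∑' i : ℕ, s ^ i * (initialSum c a F (i + 1) N : ℂ)) := by
  have : frac c θ a F N = fun t => ∑ k ∈ Finset.range (N + 1), c k * rl θ (F (a + k)) t := rfl
  rw [this, laplace_sum fun k _ => (h.transformable_rl (a + k) s hs).const_mul (c k),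
    initialSum_tsum, Finset.mul_sum, Finset.sum_mul, ← Finset.sum_sub_distrib, Finset.mul_sum]
  refine Finset.sum_congr rfl fun k _ => ?_
  rw [laplace_const_mul, laplace_rl h.nonneg hs (h.transformable _ s hs),
    h.tower.laplace_eq h.transformable hs, pow_add]
  ring

theorem FracDominated.integrableOn_limit (h : FracDominated ρ c θ a F α) {G : ℝ → ℝ}
    (hG : ∀ᵐ t ∂volume.restrict (Ioi 0), Tendsto (fun N => frac c θ a F N t) atTop (𝓝 (G t))) :
    IntegrableOn G (Ioi 0) := by
  refine Integrable.mono' h.integrable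
    (aestronglyMeasurable_of_tendsto_ae atTop h.aestronglyMeasurable_frac hG) ?_
  have h1 : ∀ᵐ t ∂volume.restrict (Ioi 0), ∀ N ≥ 1, |frac c θ a F N t| ≤ α t := by
    rw [ae_all_iff]; intro N
    by_cases hN : N ≥ 1
    · filter_upwards [h.bound N hN] with t ht _ using ht
    · exact Eventually.of_forall fun t h => absurd h hN
  filter_upwards [h1, hG] with t ht hl
  refine le_of_tendsto hl.norm ?_
  filter_upwards [eventually_ge_atTop 1] with N hN using ht N hN

/-- Both sides of `laplace_frac` pass to the limit: the left by the majorant α, since |e^(-st)| ≤ 1,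
and the right by convergence of the entire series and of the initial series. -/
theorem FracDominated.laplace_limit (h : FracDominated ρ c θ a F α) {l : ℕ → ℝ}
    (hl : ∀ i, Tendsto (initialSum c a F (i + 1)) atTop (𝓝 (l i))) {G : ℝ → ℝ}
    (hG : ∀ᵐ t ∂volume.restrict (Ioi 0), Tendsto (fun N => frac c θ a F N t) atTop (𝓝 (G t)))
    {s : ℂ} (hs : 0 < s.re) : laplace G s = s ^ (-θ : ℂ) *
      (s ^ a * (∑' k : ℕ, (c k : ℂ) * s ^ k) * laplace (F 0) s - ∑' i : ℕ, s ^ i * (l i : ℂ)) := by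
  have h1 : Tendsto (fun N => laplace (frac c θ a F N) s) atTop (𝓝 (laplace G s)) := by
    refine tendsto_integral_filter_of_dominated_convergence α
      (Eventually.of_forall fun N => (h.transformable_frac N s hs).aestronglyMeasurable) ?_
      h.integrable ?_
    · filter_upwards [eventually_ge_atTop 1] with N hN
      filter_upwards [h.bound N hN, ae_restrict_mem measurableSet_Ioi] with t ht ht0
      rw [norm_mul, Complex.norm_exp, Complex.norm_real, Real.norm_eq_abs]
      refine le_trans (mul_le_of_le_one_left (abs_nonneg _) ?_) ht
      simp only [Complex.mul_re, Complex.neg_re, Complex.ofReal_re, Complex.ofReal_im,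
        mul_zero, sub_zero, Real.exp_le_one_iff]
      exact mul_nonpos_of_nonpos_of_nonneg (by linarith) (le_of_lt ht0)
    · filter_upwards [hG] with t ht
      exact ((Complex.continuous_ofReal.tendsto _).comp ht).const_mul _
  refine tendsto_nhds_unique h1 ?_
  simp only [h.laplace_frac _ hs]
  have h2 : Tendsto (fun N => ∑ k ∈ Finset.range (N + 1), (c k : ℂ) * s ^ k) atTop
      (𝓝 (∑' k : ℕ, (c k : ℂ) * s ^ k)) :=
    (h.coeff.summable_complex s).hasSum.tendsto_sum_nat.comp (tendsto_add_atTop_nat 1)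
  exact (((h2.const_mul _).mul_const _).sub (h.tendsto_initialSum hl s)).const_mul _

end

/-! ### Test functions -/

theorem integral_Ioi_eq_interval {g : ℝ → ℝ} {R : ℝ} (hR : 0 ≤ R) (hg : ∀ t, R < t → g t = 0) :
    ∫ t in Ioi (0 : ℝ), g t = ∫ t in (0 : ℝ)..R, g t := by
  rw [intervalIntegral.integral_of_le hR]
  refine (setIntegral_eq_of_subset_of_forall_sdiff_eq_zero measurableSet_Ioi
    Ioc_subset_Ioi_self fun t ht => hg t ?_)
  by_contra hlt
  exact ht.2 ⟨ht.1, not_lt.1 hlt⟩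

theorem HasCompactSupport.exists_bound {w : ℝ → ℝ} (hw : HasCompactSupport w) :
    ∃ R : ℝ, 0 < R ∧ ∀ t, R ≤ t → w t = 0 ∧ deriv w t = 0 := by
  obtain ⟨R, hR, hsub⟩ := hw.isCompact.isBounded.subset_ball_lt 0 0
  refine ⟨R, hR, fun t ht => ?_⟩
  have : t ∉ tsupport w := fun h => by
    have := hsub h
    rw [mem_ball_zero_iff, Real.norm_eq_abs] at this
    exact absurd (le_abs_self t) (by linarith)
  exact ⟨image_eq_zero_of_notMem_tsupport this, Function.notMem_support.1
    fun h => this (support_deriv_subset h)⟩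

theorem LocInt.integrableOn_mul {f v : ℝ → ℝ} (hf : LocInt f) (hv : Continuous v) {R : ℝ}
    (hR : 0 ≤ R) (hv0 : ∀ t, R ≤ t → v t = 0) :
    IntegrableOn (fun t => f t * v t) (Ioi 0) := by
  have h1 : IntegrableOn (fun t => f t * v t) (Ioc 0 R) := by
    rw [← intervalIntegrable_iff_integrableOn_Ioc_of_le hR]
    exact (hf R hR).mul_continuousOn hv.continuousOn
  refine h1.of_forall_sdiff_eq_zero measurableSet_Ioi fun t ht => ?_
  have : R ≤ t := by
    by_contra hlt
    exact ht.2 ⟨ht.1, (not_le.1 hlt).le⟩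
  rw [hv0 t this, mul_zero]

/-- Integration by parts with the primitive that vanishes at 0, so no boundary term appears although
w(0) is arbitrary. -/
theorem integral_mul_eq_neg_integral_rl {f w : ℝ → ℝ} (hf : ContinuousOn f (Ici 0))
    (hw : ContDiff ℝ ∞ w) (hs : HasCompactSupport w) :
    ∫ t in Ioi (0 : ℝ), f t * w t = -∫ t in Ioi (0 : ℝ), rl 1 f t * deriv w t := by
  obtain ⟨R, hR, hw0⟩ := HasCompactSupport.exists_bound hs
  have hsub : Icc 0 R ⊆ Ici (0 : ℝ) := Icc_subset_Ici_self
  have hint := locInt_of_continuousOn hf R hR.le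
  rw [integral_Ioi_eq_interval hR.le fun t ht => by rw [(hw0 t ht.le).1, mul_zero],
    integral_Ioi_eq_interval hR.le fun t ht => by rw [(hw0 t ht.le).2, mul_zero]]
  have hdw : Continuous (deriv w) := hw.continuous_deriv (by simp)
  have := intervalIntegral.integral_mul_deriv_eq_deriv_mul_of_hasDerivAt (a := 0) (b := R)
    (u := rl 1 f) (u' := f) (v := w) (v' := deriv w) ?_ hw.continuous.continuousOn ?_ ?_ hint
    (hdw.intervalIntegrable _ _)
  · rw [this, (hw0 R le_rfl).1, rl_one f 0]
    simp
  · have h1 : rl 1 f = fun t => ∫ τ in (0 : ℝ)..t, f τ := funext (rl_one f)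
    rw [h1]
    refine intervalIntegral.continuousOn_primitive_interval ?_
    exact ((intervalIntegrable_iff').1 hint)
  · intro x hx
    rw [min_eq_left hR.le, max_eq_right hR.le] at hx
    have h1 : rl 1 f = fun t => ∫ τ in (0 : ℝ)..t, f τ := funext (rl_one f)
    rw [h1]
    have hopen : ContinuousOn f (Ioi 0) := hf.mono Ioi_subset_Ici_self
    exact intervalIntegral.integral_hasDerivAt_right
      (locInt_of_continuousOn hf x hx.1.le)
      (hopen.stronglyMeasurableAtFilter isOpen_Ioi x hx.1)
      (hopen.continuousAt (Ioi_mem_nhds hx.1))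
  · exact fun x _ => (hw.differentiable (by simp) x).hasDerivAt

/-- The primitive vanishing to the right of the support need not vanish on the left. It is cut off
on [-1, 0], which leaves the half-line t > 0 untouched. -/
theorem exists_primitive_test {χ : ℝ → ℝ} (hχ : ContDiff ℝ ∞ χ) (hs : HasCompactSupport χ) :
    ∃ w : ℝ → ℝ, ContDiff ℝ ∞ w ∧ HasCompactSupport w ∧ ∀ t, 0 < t → deriv w t = χ t := by
  obtain ⟨R, hR, hχ0⟩ := HasCompactSupport.exists_bound hs
  set Φ : ℝ → ℝ := fun t => ∫ τ in R..t, χ τ with hΦ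
  have hder : ∀ t, HasDerivAt Φ (χ t) t := fun t =>
    intervalIntegral.integral_hasDerivAt_right (hχ.continuous.intervalIntegrable _ _)
      (hχ.continuous.stronglyMeasurableAtFilter _ _) hχ.continuous.continuousAt
  have hΦs : ContDiff ℝ ∞ Φ := by
    rw [contDiff_infty_iff_deriv]
    refine ⟨fun t => (hder t).differentiableAt, ?_⟩
    rwa [show deriv Φ = χ from funext fun t => (hder t).deriv]
  have hΦ0 : ∀ t, R ≤ t → Φ t = 0 := fun t ht => by
    rw [hΦ]
    simp only
    rw [intervalIntegral.integral_congr (g := fun _ => 0) fun τ hτ => ?_]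
    · simp
    · rw [uIcc_of_le ht] at hτ
      exact (hχ0 τ hτ.1).1
  refine ⟨fun t => Real.smoothTransition (t + 1) * Φ t, ?_, ?_, fun t ht => ?_⟩
  · exact (Real.smoothTransition.contDiff.comp (contDiff_id.add contDiff_const)).mul hΦs
  · refine HasCompactSupport.intro (isCompact_Icc (a := -1) (b := R)) fun t ht => ?_
    rcases le_or_gt (-1) t with h1 | h1
    · have : R ≤ t := by
        by_contra hlt
        exact ht ⟨h1, (not_le.1 hlt).le⟩
      rw [hΦ0 t this, mul_zero]
    · rw [Real.smoothTransition.zero_of_nonpos (by linarith), zero_mul]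
  · have : (fun t => Real.smoothTransition (t + 1) * Φ t) =ᶠ[𝓝 t] Φ := by
      filter_upwards [Ioi_mem_nhds ht] with x hx
      have : (0 : ℝ) < x := hx
      rw [Real.smoothTransition.one_of_one_le (by linarith), one_mul]
    rw [this.deriv_eq, (hder t).deriv]

theorem LocInt.locallyIntegrable_indicator {f : ℝ → ℝ} (hf : LocInt f) :
    LocallyIntegrable (indicator (Ioi 0) f) := by
  rw [locallyIntegrable_iff]
  intro K hK
  obtain ⟨R, hR, hsub⟩ := hK.isBounded.subset_closedBall_lt 0 0
  have h1 : IntegrableOn f (Ioc 0 R) :=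
    (intervalIntegrable_iff_integrableOn_Ioc_of_le hR.le).1 (hf R hR.le)
  rw [integrableOn_indicator_iff measurableSet_Ioi]
  refine h1.mono_set fun t ht => ?_
  have := hsub ht.2
  rw [mem_closedBall_zero_iff, Real.norm_eq_abs] at this
  exact ⟨ht.1, (le_abs_self t).trans this⟩

theorem ae_eq_of_forall_integral_deriv {f g : ℝ → ℝ} (hf : LocInt f) (hg : LocInt g)
    (h : ∀ w : ℝ → ℝ, ContDiff ℝ ∞ w → HasCompactSupport w →
      ∫ t in Ioi (0 : ℝ), f t * deriv w t = ∫ t in Ioi (0 : ℝ), g t * deriv w t) :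
    f =ᵐ[volume.restrict (Ioi 0)] g := by
  have := ae_eq_of_integral_contDiff_smul_eq hf.locallyIntegrable_indicator
    hg.locallyIntegrable_indicator fun χ hχ hs => by
      obtain ⟨w, hw, hws, hd⟩ := exists_primitive_test hχ hs
      have key : ∀ f : ℝ → ℝ, ∫ t, χ t • indicator (Ioi 0) f t =
          ∫ t in Ioi (0 : ℝ), f t * deriv w t := fun f => by
        rw [← integral_indicator measurableSet_Ioi]
        refine integral_congr_ae (Eventually.of_forall fun t => ?_)
        by_cases ht : t ∈ Ioi (0 : ℝ)
        · simp only [indicator_of_mem ht, smul_eq_mul, hd t ht, mul_comm]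
        · simp [indicator_of_notMem ht]
      rw [key, key, h w hw hws]
  rw [EventuallyEq, ae_restrict_iff' measurableSet_Ioi]
  filter_upwards [this] with t ht hmem
  rwa [indicator_of_mem hmem, indicator_of_mem hmem] at ht

/-- The primitives are continuous, so they agree everywhere on [0, T], and Lebesgue differentiation
recovers the integrands. Unlike `rl_injective`, this needs no growth bound. -/
theorem ae_eq_of_rl_one_ae_eq {f g : ℝ → ℝ} (hf : LocInt f) (hg : LocInt g)
    (h : rl 1 f =ᵐ[volume.restrict (Ioi 0)] rl 1 g) : f =ᵐ[volume.restrict (Ioi 0)] g := by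
  refine ae_Ioi_of_forall_Ioc fun T hT => ?_
  have h0 := (ae_restrict_iff' measurableSet_Ioi).1 h
  have hz : ∀ t ∈ Icc (0 : ℝ) T, ∫ τ in (0 : ℝ)..t, (f τ - g τ) = 0 := by
    have hd : IntervalIntegrable (fun τ => f τ - g τ) volume 0 T := (hf T hT).sub (hg T hT)
    have hcont : ContinuousOn (fun t => ∫ τ in (0 : ℝ)..t, (f τ - g τ)) (Icc 0 T) := by
      have := intervalIntegral.continuousOn_primitive_interval ((intervalIntegrable_iff').1 hd)
      rwa [uIcc_of_le hT] at this
    rcases hT.eq_or_lt with rfl | hT'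
    · intro t ht
      rw [Icc_self, mem_singleton_iff] at ht
      simp [ht]
    · have := Measure.eqOn_Icc_of_ae_eq volume hT'.ne (f := fun t => ∫ τ in (0 : ℝ)..t, (f τ - g τ))
        (g := fun _ => 0) ?_ hcont continuousOn_const
      · exact this
      · rw [EventuallyEq, ae_restrict_iff' measurableSet_Icc]
        have hne : ∀ᵐ t : ℝ, t ≠ 0 := by simp [ae_iff, measure_singleton]
        filter_upwards [h0, hne] with t ht ht0 hmem
        have hpos : 0 < t := lt_of_le_of_ne hmem.1 (Ne.symm ht0)
        have := ht hpos
        rw [rl_one, rl_one] at this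
        rw [intervalIntegral.integral_sub (hf t hmem.1) (hg t hmem.1), this, sub_self]
  have hd : IntervalIntegrable (fun τ => f τ - g τ) volume 0 T := (hf T hT).sub (hg T hT)
  rw [ae_restrict_iff' measurableSet_Ioc]
  have hne : ∀ᵐ t : ℝ, t ≠ T := by simp [ae_iff, measure_singleton]
  filter_upwards [hd.ae_hasDerivAt_integral, hne] with t ht htT hmem
  have h1 := ht (by rw [uIcc_of_le hT]; exact ⟨hmem.1.le, hmem.2⟩) 0 left_mem_uIcc
  have hlt : t < T := lt_of_le_of_ne hmem.2 htT
  have h2 : HasDerivAt (fun t => ∫ τ in (0 : ℝ)..t, (f τ - g τ)) 0 t := by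
    refine (hasDerivAt_const t (0 : ℝ)).congr_of_eventuallyEq ?_
    filter_upwards [Ioo_mem_nhds hmem.1 hlt] with x hx
    exact hz x ⟨hx.1.le, hx.2.le⟩
  exact sub_eq_zero.1 (h1.unique h2)

theorem locInt_of_locallyIntegrableOn {f : ℝ → ℝ} (hf : LocallyIntegrableOn f (Ici 0)) :
    LocInt f := fun T hT => by
  rw [intervalIntegrable_iff_integrableOn_Icc_of_le hT]
  exact hf.integrableOn_compact_subset Icc_subset_Ici_self isCompact_Icc

theorem LocInt.locallyIntegrableOn {f : ℝ → ℝ} (hf : LocInt f) :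
    LocallyIntegrableOn f (Ici 0) := by
  rw [locallyIntegrableOn_iff isClosed_Ici.isLocallyClosed]
  intro K hK hKc
  obtain ⟨R, hR, hsub⟩ := hKc.isBounded.subset_closedBall_lt 0 0
  have h1 := (intervalIntegrable_iff_integrableOn_Icc_of_le hR.le).1 (hf R hR.le)
  refine h1.mono_set fun t ht => ⟨hK ht, ?_⟩
  have := hsub ht
  rw [mem_closedBall_zero_iff, Real.norm_eq_abs] at this
  exact (le_abs_self t).trans this

/-! ### Ordinary operators of infinite order -/

/-- The derivatives of the partial sums of `∑ₖ cₖ F_(d+k)`. -/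
noncomputable def ord (c : ℕ → ℝ) (d : ℕ) (F : ℕ → ℝ → ℝ) (N j : ℕ) (t : ℝ) : ℝ :=
  ∑ k ∈ Finset.range (N + 1), c k * F (d + (k + j)) t

/-- The limit of the integrals of order `e` of the partial sums `ord c d F N 0`, where `G` is the
limit of the fractional partial sums and `l` the limit of the initial data. -/
noncomputable def ordLimit (θ : ℝ) (b : ℕ) (l : ℕ → ℝ) (G : ℝ → ℝ) (e t : ℝ) : ℝ :=
  rl (e + b - θ) G t + ∑ j ∈ Finset.range b, l (b - 1 - j) * kern (e + j + 1) t

section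
variable {ρ θ : ℝ} {c : ℕ → ℝ} {d b : ℕ} {F : ℕ → ℝ → ℝ} {α : ℝ → ℝ}

theorem FracDominated.isTower_ord (h : FracDominated ρ c θ (d + b) F α) (N : ℕ) :
    IsTower (ord c d F N) := (h.tower.shift d).combination c _

theorem FracDominated.transformable_ord (h : FracDominated ρ c θ (d + b) F α) (N j : ℕ) :
    Transformable (ord c d F N j) := fun s hs =>
  LaplaceConvergent.sum fun k _ => (h.transformable (d + (k + j)) s hs).const_mul (c k)

theorem FracDominated.laplace_frac_eq (h : FracDominated ρ c θ (d + b) F α) (N : ℕ) {s : ℂ}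
    (hs : 0 < s.re) :
    laplace (frac c θ (d + b) F N) s = s ^ (-θ : ℂ) * laplace (ord c d F N b) s := by
  have e1 : frac c θ (d + b) F N =
      fun t => ∑ k ∈ Finset.range (N + 1), c k * rl θ (F (d + b + k)) t := rfl
  have e2 : ord c d F N b =
      fun t => ∑ k ∈ Finset.range (N + 1), c k * F (d + (k + b)) t := rfl
  rw [e1, e2, laplace_sum fun k _ => (h.transformable_rl _ s hs).const_mul (c k),
    laplace_sum fun k _ => (h.transformable _ s hs).const_mul (c k), Finset.mul_sum]
  refine Finset.sum_congr rfl fun k _ => ?_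
  rw [laplace_const_mul, laplace_const_mul, laplace_rl h.nonneg hs (h.transformable _ s hs),
    show d + (k + b) = d + b + k by ring]
  ring

theorem ord_zero (c : ℕ → ℝ) {d b : ℕ} (F : ℕ → ℝ → ℝ) (N : ℕ) {j : ℕ} (hj : j < b) :
    ord c d F N j 0 = initialSum c (d + b) F (b - 1 - j + 1) N := by
  -- For j < b the index of the initial sum is at most b, so the filter keeps every n.
  rw [initialSum, Finset.filter_true_of_mem fun n _ => by omega, ord]
  refine Finset.sum_congr rfl fun n _ => ?_
  rw [show d + b + n - (b - 1 - j + 1) = d + (n + j) by omega]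

/-- Taylor's formula of order b for `ord`, integrated e times: J^θ of its b-th derivative is `frac`,
so J^(e+b) of that derivative is J^(e+b-θ) of `frac`, and the Taylor coefficients at 0 are initial
sums. -/
theorem FracDominated.rl_ord (h : FracDominated ρ c θ (d + b) F α) {e : ℝ} (he : 0 ≤ e)
    (heb : 0 ≤ e + b - θ) (N : ℕ) :
    rl e (ord c d F N 0) =ᵐ[volume.restrict (Ioi 0)]
      ordLimit θ b (fun i => initialSum c (d + b) F (i + 1) N) (frac c θ (d + b) F N) e := by
  have hk : ∀ j : ℕ, 0 < e + j + 1 := fun j => by positivity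
  have hconv : ∀ s : ℂ, 0 < s.re → ∀ j ∈ Finset.range b, LaplaceConvergent (fun t =>
      initialSum c (d + b) F (b - 1 - j + 1) N * kern (e + j + 1) t) s := fun s hs j _ =>
    (transformable_kern (hk j) s hs).const_mul _
  refine ae_eq_of_laplace_eq ((h.transformable_ord N 0).rl he)
    (fun s hs => ((h.transformable_frac N).rl heb s hs).add
      (LaplaceConvergent.sum (hconv s hs))) fun s hs => ?_
  have hs0 : s ≠ 0 := fun h => by simp [h] at hs
  have e1 : ordLimit θ b (fun i => initialSum c (d + b) F (i + 1) N) (frac c θ (d + b) F N) e =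
    fun t => rl (e + b - θ) (frac c θ (d + b) F N) t + ∑ j ∈ Finset.range b,
      initialSum c (d + b) F (b - 1 - j + 1) N * kern (e + j + 1) t := rfl
  rw [e1, laplace_add ((h.transformable_frac N).rl heb s hs) (LaplaceConvergent.sum (hconv s hs)),
    laplace_rl heb hs (h.transformable_frac N s hs), laplace_sum (hconv s hs),
    laplace_rl he hs (h.transformable_ord N 0 s hs), h.laplace_frac_eq N hs,
    (h.isTower_ord N).laplace_eq (h.transformable_ord N) hs b, ← mul_assoc,
    ← Complex.cpow_add _ _ hs0]
  have hexp : -((e + b - θ : ℝ) : ℂ) + -(θ : ℂ) = -(e : ℂ) - (b : ℂ) := by push_cast; ring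
  rw [hexp, mul_sub, ← mul_assoc, ← Complex.cpow_natCast s b, ← Complex.cpow_add _ _ hs0,
    sub_add_cancel, Finset.mul_sum, sub_add, eq_comm, sub_eq_self,
    ← Finset.sum_sub_distrib]
  refine Finset.sum_eq_zero fun j hj => ?_
  have hj' := Finset.mem_range.1 hj
  rw [laplace_const_mul, laplace_kern (hk j) hs, ord_zero c F N hj', sub_eq_zero, ← mul_assoc,
    ← Complex.cpow_natCast s (b - 1 - j), ← Complex.cpow_add _ _ hs0, mul_comm]
  congr 2
  rw [Nat.cast_sub (by omega), Nat.cast_sub (by omega)]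
  push_cast; ring

theorem FracDominated.tendsto_rl_ord (h : FracDominated ρ c θ (d + b) F α) {e : ℝ} (he : 0 ≤ e)
    (heb : 0 ≤ e + b - θ) {l : ℕ → ℝ}
    (hl : ∀ i, Tendsto (initialSum c (d + b) F (i + 1)) atTop (𝓝 (l i))) {G : ℝ → ℝ}
    (hG : ∀ᵐ t ∂volume.restrict (Ioi 0),
      Tendsto (fun N => frac c θ (d + b) F N t) atTop (𝓝 (G t))) :
    (∀ᵐ t ∂volume.restrict (Ioi 0), Tendsto (fun N => rl e (ord c d F N 0) t) atTop
      (𝓝 (ordLimit θ b l G e t))) ∧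
    ∃ B, Transformable B ∧ ∀ᵐ t ∂volume.restrict (Ioi 0), ∀ N ≥ 1,
      |rl e (ord c d F N 0) t| ≤ B t := by
  have hmain := rl_tendsto heb h.integrable h.aestronglyMeasurable_frac h.bound hG
  have heq : ∀ᵐ t ∂volume.restrict (Ioi 0), ∀ N, rl e (ord c d F N 0) t =
      ordLimit θ b (fun i => initialSum c (d + b) F (i + 1) N) (frac c θ (d + b) F N) e t :=
    ae_all_iff.2 fun N => h.rl_ord he heb N
  have hb : ∀ i, ∃ M, ∀ N, |initialSum c (d + b) F (i + 1) N| ≤ M := fun i => by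
    obtain ⟨M, hM⟩ := (hl i).norm.bddAbove_range
    exact ⟨M, fun N => hM ⟨N, rfl⟩⟩
  choose M hM using hb
  have hk : ∀ j : ℕ, 0 < e + j + 1 := fun j => by positivity
  refine ⟨?_, fun t => rl (e + b - θ) α t +
    ∑ j ∈ Finset.range b, M (b - 1 - j) * kern (e + j + 1) t, ?_, ?_⟩
  · filter_upwards [hmain, heq] with t h1 h2
    simp only [h2]
    exact h1.1.add (tendsto_finsetSum _ fun j _ => (hl (b - 1 - j)).mul_const _)
  · exact fun s hs => ((IntegrableOn.transformable h.integrable).rl heb s hs).add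
      (LaplaceConvergent.sum fun j _ => (transformable_kern (hk j) s hs).const_mul _)
  · filter_upwards [hmain, heq, ae_restrict_mem measurableSet_Ioi] with t h1 h2 ht N hN
    rw [h2]
    refine (abs_add_le _ _).trans (add_le_add (h1.2 N hN) ?_)
    refine (Finset.abs_sum_le_sum_abs _ _).trans (Finset.sum_le_sum fun j _ => ?_)
    have hkn := kern_nonneg (hk j) (le_of_lt ht)
    rw [abs_mul, abs_of_nonneg hkn]
    exact mul_le_mul_of_nonneg_right (hM _ N) hkn

theorem transformable_ordLimit {e : ℝ} (he : 0 ≤ e) (heb : 0 ≤ e + b - θ) (l : ℕ → ℝ) {G : ℝ → ℝ}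
    (hG : Transformable G) : Transformable (ordLimit θ b l G e) := fun s hs =>
  (hG.rl heb s hs).add (LaplaceConvergent.sum fun j _ =>
    (transformable_kern (by positivity : 0 < e + j + 1) s hs).const_mul _)

/-- The power functions depend on l alone and cancel; what remains is injectivity of the
Riemann-Liouville integral. -/
theorem ordLimit_ae_eq_iff {e : ℝ} (heb : 0 ≤ e + b - θ) (l : ℕ → ℝ) {G H : ℝ → ℝ}
    (hG : Transformable G) (hH : Transformable H) :
    ordLimit θ b l G e =ᵐ[volume.restrict (Ioi 0)] ordLimit θ b l H e ↔
      G =ᵐ[volume.restrict (Ioi 0)] H := by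
  constructor
  · intro heq
    refine rl_injective heb hG hH ?_
    filter_upwards [heq] with t ht
    exact add_right_cancel ht
  · intro heq
    filter_upwards [rl_congr_ae_Ioi (μ := e + b - θ) heq] with t ht
    simp only [ordLimit, ht]

/-- One derivative is moved onto w. The primitives J^1 of the partial sums converge under a majorant
because 1 + b - θ ≥ 0 always holds. -/
theorem FracDominated.tendsto_weak (h : FracDominated ρ c θ (d + b) F α) {l : ℕ → ℝ}
    (hl : ∀ i, Tendsto (initialSum c (d + b) F (i + 1)) atTop (𝓝 (l i))) {G : ℝ → ℝ}
    (hG : ∀ᵐ t ∂volume.restrict (Ioi 0),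
      Tendsto (fun N => frac c θ (d + b) F N t) atTop (𝓝 (G t))) {w : ℝ → ℝ}
    (hw : ContDiff ℝ ∞ w) (hs : HasCompactSupport w) :
    Tendsto (fun N => ∫ t in Ioi (0 : ℝ), ord c d F N 0 t * w t) atTop
      (𝓝 (-∫ t in Ioi (0 : ℝ), ordLimit θ b l G 1 t * deriv w t)) := by
  have h1b : 0 ≤ 1 + (b : ℝ) - θ := by have := h.le_one; have : (0 : ℝ) ≤ b := b.cast_nonneg; linarith
  obtain ⟨hlim, B, hB, hbd⟩ := h.tendsto_rl_ord zero_le_one h1b hl hG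
  obtain ⟨R, hR, hw0⟩ := HasCompactSupport.exists_bound hs
  have hdw : Continuous (deriv w) := hw.continuous_deriv (by simp)
  simp only [fun N => integral_mul_eq_neg_integral_rl ((h.isTower_ord N).cont 0) hw hs]
  refine Tendsto.neg ?_
  refine tendsto_integral_filter_of_dominated_convergence (fun t => B t * |deriv w t|)
    (Eventually.of_forall fun N => ?_) ?_ ?_ ?_
  · exact (aestronglyMeasurable_Ioi ((h.transformable_ord N 0).rl zero_le_one).locInt).mul
      hdw.aestronglyMeasurable
  · filter_upwards [eventually_ge_atTop 1] with N hN
    filter_upwards [hbd] with t ht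
    rw [norm_mul, Real.norm_eq_abs, Real.norm_eq_abs]
    exact mul_le_mul_of_nonneg_right (ht N hN) (abs_nonneg _)
  · exact hB.locInt.integrableOn_mul hdw.abs hR.le fun t ht => by rw [(hw0 t ht).2, abs_zero]
  · filter_upwards [hlim] with t ht using ht.mul_const _

/-- Local domination allows J^1 to be exchanged with the limit, so the pointwise limit A is tied to
the limit already known for the primitives. -/
theorem FracDominated.rl_one_limit (h : FracDominated ρ c θ (d + b) F α) {l : ℕ → ℝ}
    (hl : ∀ i, Tendsto (initialSum c (d + b) F (i + 1)) atTop (𝓝 (l i))) {G : ℝ → ℝ}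
    (hG : ∀ᵐ t ∂volume.restrict (Ioi 0),
      Tendsto (fun N => frac c θ (d + b) F N t) atTop (𝓝 (G t))) {A B : ℝ → ℝ}
    (hA : ∀ᵐ t ∂volume.restrict (Ioi 0), Tendsto (fun N => ord c d F N 0 t) atTop (𝓝 (A t)))
    (hB : LocInt B) (hbd : ∀ N ≥ 1, ∀ᵐ t ∂volume.restrict (Ioi 0), |ord c d F N 0 t| ≤ B t) :
    LocInt A ∧ rl 1 A =ᵐ[volume.restrict (Ioi 0)] ordLimit θ b l G 1 := by
  have h1b : 0 ≤ 1 + (b : ℝ) - θ := by have := h.le_one; have : (0 : ℝ) ≤ b := b.cast_nonneg; linarith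
  have hm := fun N => aestronglyMeasurable_Ioi ((h.isTower_ord N).locInt 0)
  have hbd' : ∀ᵐ t ∂volume.restrict (Ioi 0), ∀ N ≥ 1, |ord c d F N 0 t| ≤ B t := by
    rw [ae_all_iff]; intro N
    by_cases hN : N ≥ 1
    · filter_upwards [hbd N hN] with t ht _ using ht
    · exact Eventually.of_forall fun t h => absurd h hN
  have hAB : ∀ᵐ t ∂volume.restrict (Ioi 0), ‖A t‖ ≤ B t := by
    filter_upwards [hbd', hA] with t ht hl
    refine le_of_tendsto hl.norm ?_
    filter_upwards [eventually_ge_atTop 1] with N hN using ht N hN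
  refine ⟨fun T hT => ?_, ?_⟩
  · have hBT := (intervalIntegrable_iff_integrableOn_Ioc_of_le hT).1 (hB T hT)
    rw [intervalIntegrable_iff_integrableOn_Ioc_of_le hT]
    exact Integrable.mono' hBT ((aestronglyMeasurable_of_tendsto_ae atTop hm hA).mono_set
      Ioc_subset_Ioi_self) (ae_restrict_of_ae_restrict_of_subset Ioc_subset_Ioi_self hAB)
  · filter_upwards [(h.tendsto_rl_ord zero_le_one h1b hl hG).1,
      ae_restrict_mem measurableSet_Ioi] with t ht ht0
    refine tendsto_nhds_unique ?_ ht
    simp only [rl_one]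
    have ht0' : 0 < t := ht0
    have hsub : Ioc 0 t ⊆ Ioi (0 : ℝ) := Ioc_subset_Ioi_self
    refine intervalIntegral.tendsto_integral_filter_of_dominated_convergence B
      (Eventually.of_forall fun N => ?_) ?_ (hB t ht0'.le) ?_
    · rw [uIoc_of_le ht0'.le]
      exact (hm N).mono_set hsub
    · filter_upwards [eventually_ge_atTop 1] with N hN
      filter_upwards [(ae_restrict_iff' measurableSet_Ioi).1 hbd'] with τ hτ hmem
      rw [uIoc_of_le ht0'.le] at hmem
      exact hτ (hsub hmem) N hN
    · filter_upwards [(ae_restrict_iff' measurableSet_Ioi).1 hA] with τ hτ hmem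
      rw [uIoc_of_le ht0'.le] at hmem
      exact hτ (hsub hmem)

end

/-! ### Modified Bessel functions -/

theorem besselCoeff_p {ν : ℝ} (hν : -1 < ν) : BesselCoeff ν (p ν) := by
  refine ⟨hν, fun k => ?_, fun k => ?_⟩
  · have hk : (0 : ℝ) ≤ k := k.cast_nonneg
    have := Real.Gamma_pos_of_pos (by linarith : 0 < ν + k + 1)
    unfold p; positivity
  · have hk : (0 : ℝ) ≤ k := k.cast_nonneg
    have h1 : 0 < ν + k + 1 := by linarith
    have h2 := Real.Gamma_pos_of_pos h1
    have h3 := Real.Gamma_add_one h1.ne'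
    unfold p
    rw [show ν + ((k + 1 : ℕ) : ℝ) + 1 = ν + k + 1 + 1 by push_cast; ring, h3,
      show (((k + 1 : ℕ) : ℝ) + ν / 2) = (k + ν / 2) + 1 by push_cast; ring,
      Real.rpow_add_one (by norm_num), Nat.factorial_succ]
    push_cast
    have h4 : (0 : ℝ) < 4 ^ ((k : ℝ) + ν / 2) := by positivity
    have h5 : (k ! : ℝ) ≠ 0 := by positivity
    field_simp

theorem q_eq_p (ν : ℝ) : q ν = p (ν + 2) := by
  ext k
  unfold p q
  rw [show ν + 2 + k + 1 = ν + k + 3 by ring, show (k : ℝ) + (ν + 2) / 2 = k + 1 + ν / 2 by ring]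

theorem besselISqrt_eq (μ : ℝ) {s : ℂ} (hs : s ≠ 0) :
    besselISqrt μ s = s ^ ((μ / 2 : ℝ) : ℂ) * ∑' k : ℕ, (p μ k : ℂ) * s ^ k := by
  rw [besselISqrt, besselI, ← tsum_mul_left]
  refine tsum_congr fun k => ?_
  set z : ℂ := Complex.log s / 2 - (Real.log 2 : ℝ) with hz
  have hzexp : s.sqrt / 2 = Complex.exp z := by
    rw [sqrt_eq_exp hs, hz, Complex.exp_sub, ← Complex.ofReal_exp, Real.exp_log two_pos]
    simp
  have him : z.im = s.arg / 2 := by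
    rw [hz, Complex.sub_im, Complex.ofReal_im, sub_zero, ← Complex.log_im]
    exact Complex.div_ofNat_im _ _
  -- The imaginary part arg(s)/2 stays in (-π/2, π/2], so the principal logarithm returns z and the
  -- branches of √s and of the power are compatible.
  have hlog : Complex.log (Complex.exp z) = z := by
    have := Complex.neg_pi_lt_arg s
    have := Complex.arg_le_pi s
    have := Real.pi_pos
    exact Complex.log_exp (by rw [him]; linarith) (by rw [him]; linarith)
  have h4 : ((4 : ℝ) ^ ((k : ℝ) + μ / 2) : ℝ) = Real.exp (Real.log 2 * (2 * k + μ)) := by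
    rw [Real.rpow_def_of_pos (by norm_num), show (4 : ℝ) = 2 ^ 2 by norm_num, Real.log_pow]
    congr 1; push_cast; ring
  rw [hzexp, Complex.cpow_def_of_ne_zero (Complex.exp_ne_zero z), hlog,
    Complex.cpow_def_of_ne_zero hs, p, h4]
  have hsk : s ^ k = Complex.exp (Complex.log s * k) := by
    rw [← Complex.cpow_natCast, Complex.cpow_def_of_ne_zero hs]
  rw [hsk]
  push_cast
  have hexp : Complex.exp (z * (2 * k + μ)) = Complex.exp (Complex.log s * (μ / 2)) *
      Complex.exp (Complex.log s * k) / Complex.exp ((Real.log 2 : ℝ) * (2 * k + μ)) := by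
    rw [← Complex.exp_add, ← Complex.exp_sub, hz]
    congr 1; ring
  have hzz : Complex.log 2 = ((Real.log 2 : ℝ) : ℂ) := by
    rw [Complex.ofReal_log (by norm_num)]; norm_num
  rw [hexp, ← hzz]
  simp only [div_eq_mul_inv, one_mul, mul_inv]
  ring

/-! ### Differential equation and zeros of the Bessel series -/

/-- The sequence of coefficients of the derivative of a power series. -/
def shiftCoeff (c : ℕ → ℝ) (k : ℕ) : ℝ := (k + 1) * c (k + 1)

theorem BesselCoeff.shift {ρ : ℝ} {c : ℕ → ℝ} (hc : BesselCoeff ρ c) :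
    BesselCoeff (ρ + 1) (shiftCoeff c) := by
  refine ⟨by have := hc.gt; linarith, fun k => mul_pos (by positivity) (hc.pos _), fun k => ?_⟩
  unfold shiftCoeff
  rw [hc.recurrence (k + 1)]
  push_cast; ring

/-- The entire function with coefficients `c`. -/
noncomputable def entire (c : ℕ → ℝ) (s : ℂ) : ℂ := ∑' k : ℕ, (c k : ℂ) * s ^ k

theorem BesselCoeff.hasDerivAt {ρ : ℝ} {c : ℕ → ℝ} (hc : BesselCoeff ρ c) (s : ℂ) :
    HasDerivAt (entire c) (entire (shiftCoeff c) s) s := by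
  have hU : IsOpen (Metric.ball (0 : ℂ) (‖s‖ + 1)) := Metric.isOpen_ball
  have hs : s ∈ Metric.ball (0 : ℂ) (‖s‖ + 1) := by simp
  have hd : ∀ i, DifferentiableOn ℂ (fun w : ℂ => (c i : ℂ) * w ^ i)
      (Metric.ball (0 : ℂ) (‖s‖ + 1)) := fun i => by fun_prop
  have hle : ∀ (i : ℕ) (w : ℂ), w ∈ Metric.ball (0 : ℂ) (‖s‖ + 1) →
      ‖(c i : ℂ) * w ^ i‖ ≤ c i * (‖s‖ + 1) ^ i := fun i w hw => by
    rw [norm_mul, norm_pow, Complex.norm_real, Real.norm_eq_abs, abs_of_pos (hc.pos i)]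
    have := (hc.pos i).le
    have : ‖w‖ ≤ ‖s‖ + 1 := by simpa using (mem_ball_zero_iff.1 hw).le
    gcongr
  have h1 := (Complex.differentiableOn_tsum_of_summable_norm (hc.summable (‖s‖ + 1)) hd hU hle
    ).differentiableAt (hU.mem_nhds hs)
  have h2 := Complex.hasSum_deriv_of_summable_norm (hc.summable (‖s‖ + 1)) hd hU hle hs
  have h3 : deriv (fun w : ℂ => ∑' i : ℕ, (c i : ℂ) * w ^ i) s = entire (shiftCoeff c) s := by
    rw [← h2.tsum_eq, h2.summable.tsum_eq_zero_add, entire]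
    simp only [pow_zero, mul_one, deriv_const, zero_add]
    refine tsum_congr fun k => ?_
    rw [deriv_const_mul _ (by fun_prop)]
    simp [shiftCoeff]
    ring
  rw [← h3]
  exact h1.hasDerivAt

theorem BesselCoeff.entire_ode {ρ : ℝ} {c : ℕ → ℝ} (hc : BesselCoeff ρ c) (s : ℂ) :
    (ρ + 1) * entire (shiftCoeff c) s + s * entire (shiftCoeff (shiftCoeff c)) s =
      entire c s / 4 := by
  have h1 := hc.shift.summable_complex s
  have h2 := hc.shift.shift.summable_complex s
  have h3 : s * entire (shiftCoeff (shiftCoeff c)) s =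
      ∑' k : ℕ, ((k : ℂ) * (k + 1) * c (k + 1)) * s ^ k := by
    have hsum : Summable fun k : ℕ => ((k : ℂ) * (k + 1) * c (k + 1)) * s ^ k := by
      rw [← summable_nat_add_iff 1]
      refine (h2.mul_left s).congr fun k => ?_
      simp only [shiftCoeff]; push_cast; ring
    rw [hsum.tsum_eq_zero_add, entire, ← tsum_mul_left]
    simp only [Nat.cast_zero, zero_mul, zero_add]
    refine tsum_congr fun k => ?_
    simp only [shiftCoeff]; push_cast; ring
  have hsum : Summable fun k : ℕ => ((k : ℂ) * (k + 1) * c (k + 1)) * s ^ k := by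
    rw [← summable_nat_add_iff 1]
    refine (h2.mul_left s).congr fun k => ?_
    simp only [shiftCoeff]; push_cast; ring
  rw [h3, entire, ← tsum_mul_left, ← (h1.mul_left _).tsum_add hsum, entire, ← tsum_div_const]
  refine tsum_congr fun k => ?_
  rw [hc.recurrence k]
  simp only [shiftCoeff]; push_cast; ring

/-- On the ray x ↦ sx the differential equation takes the form (x^(ρ+1) g₁)' = x^ρ g / 4. Pairing
with the conjugate of g gives a function f whose derivative is a sum of two nonnegative terms when
Re s > 0. If g(1) = 0, then f vanishes at 0 and 1, hence throughout [0, 1], so g = 0 on (0, 1),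
contradicting g(0) = c₀ > 0. -/
theorem BesselCoeff.entire_ne_zero {ρ : ℝ} {c : ℕ → ℝ} (hc : BesselCoeff ρ c) {s : ℂ}
    (hs : 0 < s.re) : entire c s ≠ 0 := by
  intro hzero
  have hρ : 0 < ρ + 1 := by have := hc.gt; linarith
  set g : ℝ → ℂ := fun x => entire c (s * x) with hg
  set g₁ : ℝ → ℂ := fun x => entire (shiftCoeff c) (s * x) with hg₁
  set g₂ : ℝ → ℂ := fun x => entire (shiftCoeff (shiftCoeff c)) (s * x) with hg₂
  have hlin : ∀ x : ℝ, HasDerivAt (fun x : ℝ => s * (x : ℂ)) s x := fun x => by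
    simpa using (Complex.ofRealCLM.hasDerivAt (x := x)).const_mul s
  have dg : ∀ x, HasDerivAt g (g₁ x * s) x := fun x => (hc.hasDerivAt _).comp x (hlin x)
  have dg₁ : ∀ x, HasDerivAt g₁ (g₂ x * s) x := fun x => (hc.shift.hasDerivAt _).comp x (hlin x)
  set h : ℝ → ℂ := fun x => ((x ^ (ρ + 1) : ℝ) : ℂ) * g₁ x with hh
  have dh : ∀ x, 0 < x → HasDerivAt h ((x ^ ρ : ℝ) * (g x / 4)) x := fun x hx => by
    have h1 : HasDerivAt (fun x : ℝ => ((x ^ (ρ + 1) : ℝ) : ℂ)) (((ρ + 1) * x ^ ρ : ℝ) : ℂ) x := by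
      have := (Real.hasDerivAt_rpow_const (p := ρ + 1) (Or.inl hx.ne')).ofReal_comp
      simpa using this
    refine (h1.mul (dg₁ x)).congr_deriv ?_
    rw [hg, ← hc.entire_ode (s * x), Real.rpow_add_one hx.ne']
    push_cast; ring
  -- The extra factor s makes the g₁ term of f' equal to the real quantity x^(ρ+1) |s g₁|² and
  -- leaves Re s in front of the |g|² term.
  set f : ℝ → ℝ := fun x => (s * h x * (starRingEnd ℂ) (g x)).re with hf
  have df : ∀ x, 0 < x → HasDerivAt f
      (x ^ ρ * s.re / 4 * ‖g x‖ ^ 2 + x ^ (ρ + 1) * ‖s‖ ^ 2 * ‖g₁ x‖ ^ 2) x := fun x hx => by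
    have h1 : HasDerivAt (fun x => (starRingEnd ℂ) (g x)) ((starRingEnd ℂ) (g₁ x * s)) x :=
      Complex.conjCLE.toContinuousLinearMap.hasFDerivAt.comp_hasDerivAt x (dg x)
    have h2 := Complex.reCLM.hasFDerivAt.comp_hasDerivAt x (((dh x hx).const_mul s).mul h1)
    refine h2.congr_deriv ?_
    have e1 : s * ((x ^ ρ : ℝ) * (g x / 4)) * (starRingEnd ℂ) (g x) +
        s * h x * (starRingEnd ℂ) (g₁ x * s) = ((x ^ ρ / 4 * ‖g x‖ ^ 2 : ℝ) : ℂ) * s +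
          ((x ^ (ρ + 1) * ‖s‖ ^ 2 * ‖g₁ x‖ ^ 2 : ℝ) : ℂ) := by
      rw [map_mul]
      push_cast
      rw [← Complex.mul_conj', ← Complex.mul_conj', ← Complex.mul_conj', hh]
      ring
    rw [e1, Complex.reCLM_apply, Complex.add_re, Complex.re_ofReal_mul, Complex.ofReal_re]
    ring
  have hcont : Continuous f := by
    have c1 : Continuous g := continuous_iff_continuousAt.2 fun x => (dg x).continuousAt
    have c2 : Continuous g₁ := continuous_iff_continuousAt.2 fun x => (dg₁ x).continuousAt
    have c3 : Continuous fun x : ℝ => x ^ (ρ + 1) := Real.continuous_rpow_const hρ.le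
    have c4 : Continuous h := (Complex.continuous_ofReal.comp c3).mul c2
    exact Complex.continuous_re.comp ((continuous_const.mul c4).mul (Complex.continuous_conj.comp c1))
  have hnn : ∀ x, 0 < x →
      0 ≤ x ^ ρ * s.re / 4 * ‖g x‖ ^ 2 + x ^ (ρ + 1) * ‖s‖ ^ 2 * ‖g₁ x‖ ^ 2 := fun x hx => by
    positivity
  have hmono : MonotoneOn f (Icc 0 1) := by
    refine monotoneOn_of_deriv_nonneg (convex_Icc 0 1) hcont.continuousOn ?_ ?_ <;>
      rw [interior_Icc]
    · exact fun x hx => (df x hx.1).differentiableAt.differentiableWithinAt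
    · exact fun x hx => by rw [(df x hx.1).deriv]; exact hnn x hx.1
  have f0 : f 0 = 0 := by simp [hf, hh, Real.zero_rpow hρ.ne']
  have f1 : f 1 = 0 := by
    have : g 1 = 0 := by simpa [hg] using hzero
    simp [hf, this]
  have hconst : ∀ x ∈ Icc (0 : ℝ) 1, f x = 0 := fun x hx => le_antisymm
    (f1 ▸ hmono hx (right_mem_Icc.2 zero_le_one) hx.2)
    (f0 ▸ hmono (left_mem_Icc.2 zero_le_one) hx hx.1)
  have hg0 : ∀ x ∈ Ioo (0 : ℝ) 1, g x = 0 := fun x hx => by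
    have hd0 : HasDerivAt f 0 x := by
      refine (hasDerivAt_const x (0 : ℝ)).congr_of_eventuallyEq ?_
      filter_upwards [Ioo_mem_nhds hx.1 hx.2] with y hy using hconst y ⟨hy.1.le, hy.2.le⟩
    have heq := (df x hx.1).unique hd0
    have hx0 := hx.1
    have p1 : 0 ≤ x ^ (ρ + 1) * ‖s‖ ^ 2 * ‖g₁ x‖ ^ 2 := by positivity
    have p2 : 0 < x ^ ρ * s.re / 4 := by positivity
    by_contra hne
    have : 0 < ‖g x‖ := norm_pos_iff.2 hne
    have : 0 < x ^ ρ * s.re / 4 * ‖g x‖ ^ 2 := by positivity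
    linarith
  have hlim : Tendsto g (𝓝[>] 0) (𝓝 (g 0)) := (dg 0).continuousAt.tendsto.mono_left nhdsWithin_le_nhds
  have hlim0 : Tendsto g (𝓝[>] 0) (𝓝 0) := by
    refine tendsto_const_nhds.congr' ?_
    filter_upwards [Ioo_mem_nhdsGT (zero_lt_one' ℝ)] with x hx using (hg0 x hx).symm
  have hval : g 0 = c 0 := by
    simp only [hg, Complex.ofReal_zero, mul_zero, entire]
    rw [tsum_eq_single 0 fun k hk => by simp [hk]]
    simp
  have := tendsto_nhds_unique hlim hlim0
  rw [hval] at this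
  exact (hc.pos 0).ne' (by exact_mod_cast this)

theorem besselISqrt_ne_zero {μ : ℝ} (hμ : -1 < μ) {s : ℂ} (hs : 0 < s.re) :
    besselISqrt μ s ≠ 0 := by
  have hs0 : s ≠ 0 := fun h => by simp [h] at hs
  rw [besselISqrt_eq μ hs0]
  exact mul_ne_zero (by simp [Complex.cpow_eq_zero_iff, hs0])
    ((besselCoeff_p hμ).entire_ne_zero hs)

theorem continuousAt_besselISqrt {μ : ℝ} (hμ : -1 < μ) {s : ℂ} (hs : 0 < s.re) :
    ContinuousAt (besselISqrt μ) s := by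
  have hs0 : s ≠ 0 := fun h => by simp [h] at hs
  have h1 : ContinuousAt (fun s : ℂ => s ^ ((μ / 2 : ℝ) : ℂ) * entire (p μ) s) s :=
    (continuousAt_id.cpow continuousAt_const (Or.inl hs)).mul
      ((besselCoeff_p hμ).hasDerivAt s).continuousAt
  refine h1.congr ?_
  filter_upwards [isOpen_ne.mem_nhds hs0] with z hz
  exact (besselISqrt_eq μ hz).symm

/-! ### Creep compliances -/

theorem laplace_ofReal (f : ℝ → ℝ) (x : ℝ) :
    laplace f x = ((∫ t in Ioi (0 : ℝ), Real.exp (-x * t) * f t : ℝ) : ℂ) := by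
  rw [laplace, ← integral_complex_ofReal]
  refine integral_congr_ae (Eventually.of_forall fun t => ?_)
  push_cast
  rfl

theorem laplaceConvergent_of_integrableOn_exp {f : ℝ → ℝ} {x : ℝ}
    (h : IntegrableOn (fun t => Real.exp (-x * t) * f t) (Ioi 0)) : LaplaceConvergent f x := by
  refine (Integrable.ofReal (𝕜 := ℂ) h).congr (Eventually.of_forall fun t => ?_)
  simp

theorem LaplaceConvergent.tendsto_add_real {f : ℝ → ℝ} {s : ℂ} (hf : LaplaceConvergent f s) :
    Tendsto (fun δ : ℝ => laplace f (s + δ)) (𝓝[>] 0) (𝓝 (laplace f s)) := by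
  refine tendsto_integral_filter_of_dominated_convergence
    (fun t : ℝ => ‖Complex.exp (-s * t) * (f t : ℂ)‖) ?_ ?_ hf.norm ?_
  · filter_upwards [self_mem_nhdsWithin] with δ hδ
    refine (hf.mono ?_).aestronglyMeasurable
    simpa using le_of_lt hδ
  · filter_upwards [self_mem_nhdsWithin] with δ hδ
    filter_upwards [ae_restrict_mem measurableSet_Ioi] with t ht
    rw [norm_mul, norm_mul, Complex.norm_exp, Complex.norm_exp]
    refine mul_le_mul_of_nonneg_right (Real.exp_le_exp.2 ?_) (norm_nonneg _)
    have h1 : 0 < δ := hδ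
    have h2 : 0 < t := ht
    simp only [Complex.mul_re, Complex.neg_re, Complex.add_re, Complex.ofReal_re,
      Complex.ofReal_im, mul_zero, sub_zero]
    nlinarith [mul_pos h1 h2]
  · refine Eventually.of_forall fun t => ?_
    have : Continuous fun δ : ℝ => Complex.exp (-(s + δ) * t) * (f t : ℂ) := by fun_prop
    have h := this.tendsto 0
    simp only [Complex.ofReal_zero, add_zero] at h
    exact h.mono_left nhdsWithin_le_nhds

/-- For the truncation k of K to (0, n], the integral of e^(-xt) k equals x times that of e^(-xt)
J^1 k. Since J^1 k ≤ J^1 K ≤ J, it is bounded uniformly in n. -/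
theorem laplaceConvergent_of_rl_one_le {K J : ℝ → ℝ} {x : ℝ} (hx : 0 < x) (hK : LocInt K)
    (hK0 : ∀ t, 0 < t → 0 ≤ K t) (hJ : LaplaceConvergent J x)
    (h : ∀ t, 0 < t → rl 1 K t ≤ J t) : LaplaceConvergent K x := by
  refine laplaceConvergent_of_integrableOn_exp ?_
  have hxre : 0 < (x : ℂ).re := by simpa using hx
  have hint : ∀ n : ℕ, IntegrableOn (fun t => Real.exp (-x * t) * K t) (Ioc 0 n) := fun n => by
    rw [← intervalIntegrable_iff_integrableOn_Ioc_of_le n.cast_nonneg]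
    exact (hK n n.cast_nonneg).continuousOn_mul (by fun_prop)
  refine integrableOn_Ioi_of_intervalIntegral_norm_bounded
    (x * ∫ t in Ioi 0, Real.exp (-x * t) * J t) 0 hint tendsto_natCast_atTop_atTop
    (Eventually.of_forall fun n => ?_)
  set k := indicator (Ioc (0 : ℝ) n) K with hk
  have hkc : Transformable k := hK.truncate n.cast_nonneg
  have e1 : ∫ t in (0 : ℝ)..n, ‖Real.exp (-x * t) * K t‖ =
      ∫ t in Ioi (0 : ℝ), Real.exp (-x * t) * k t := by
    have : (fun t => Real.exp (-x * t) * k t) =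
        indicator (Ioc 0 (n : ℝ)) fun t => Real.exp (-x * t) * K t := by
      ext t
      by_cases ht : t ∈ Ioc 0 (n : ℝ)
      · rw [hk, indicator_of_mem ht, indicator_of_mem ht]
      · rw [hk, indicator_of_notMem ht, indicator_of_notMem ht, mul_zero]
    rw [this, setIntegral_indicator measurableSet_Ioc, inter_eq_right.2 Ioc_subset_Ioi_self,
      intervalIntegral.integral_of_le n.cast_nonneg]
    refine setIntegral_congr_fun measurableSet_Ioc fun t ht => ?_
    rw [Real.norm_eq_abs, abs_of_nonneg (mul_nonneg (Real.exp_pos _).le (hK0 t ht.1))]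
  have e2 := laplace_rl zero_le_one hxre (hkc x hxre)
  rw [laplace_ofReal, laplace_ofReal] at e2
  have e3 : x * ∫ t in Ioi (0 : ℝ), Real.exp (-x * t) * rl 1 k t =
      ∫ t in Ioi (0 : ℝ), Real.exp (-x * t) * k t := by
    have hx0 : (x : ℂ) ≠ 0 := by exact_mod_cast hx.ne'
    rw [← Complex.ofReal_inj, Complex.ofReal_mul, e2]
    simp only [Complex.ofReal_one, Complex.cpow_neg_one]
    field_simp
  rw [e1, ← e3]
  refine mul_le_mul_of_nonneg_left ?_ hx.le
  refine setIntegral_mono_on ((hkc.rl zero_le_one) x hxre).integrableOn_real hJ.integrableOn_real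
    measurableSet_Ioi fun t ht => ?_
  have ht0 : 0 < t := ht
  refine mul_le_mul_of_nonneg_left (le_trans ?_ (h t ht)) (Real.exp_pos _).le
  rw [rl_one, rl_one]
  refine intervalIntegral.integral_mono_on_of_le_Ioo ht0.le (hkc.locInt t ht0.le) (hK t ht0.le)
    fun τ hτ => ?_
  by_cases hmem : τ ∈ Ioc 0 (n : ℝ)
  · rw [hk, indicator_of_mem hmem]
  · rw [hk, indicator_of_notMem hmem]
    exact hK0 τ hτ.1

theorem IsCreepCompliance.locInt_deriv {J σ ε : ℝ → ℝ} (hJ : IsCreepCompliance J σ ε) :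
    LocInt (deriv J) := fun T hT => by
  rcases hT.eq_or_lt with rfl | hT
  · exact IntervalIntegrable.refl
  · exact (hJ.absCont T hT).intervalIntegrable_deriv

theorem IsCreepCompliance.rl_one_deriv {J σ ε : ℝ → ℝ} (hJ : IsCreepCompliance J σ ε) {t : ℝ}
    (ht : 0 < t) : rl 1 (deriv J) t = J t - J 0 := by
  rw [rl_one]
  exact (hJ.absCont t ht).integral_deriv_eq_sub

theorem IsCreepCompliance.deriv_nonneg {J σ ε : ℝ → ℝ} (hJ : IsCreepCompliance J σ ε) {t : ℝ}
    (ht : 0 < t) : 0 ≤ deriv J t := by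
  rw [← derivWithin_of_mem_nhds (Ici_mem_nhds ht)]
  exact hJ.mono.derivWithin_nonneg

/-- The derivative is nonnegative and its primitive J - J(0) is at most J, so convergence for J
passes to the derivative at the same abscissa. -/
theorem IsCreepCompliance.laplaceConvergent_deriv {J σ ε : ℝ → ℝ}
    (hJ : IsCreepCompliance J σ ε) {s : ℂ} (hs : 0 < s.re) (hc : LaplaceConvergent J s) :
    LaplaceConvergent (deriv J) s := by
  have h := laplaceConvergent_of_rl_one_le hs hJ.locInt_deriv (fun t ht => hJ.deriv_nonneg ht)
    (hc.mono (z := (s.re : ℂ)) (by simp)) fun t ht => by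
      rw [hJ.rl_one_deriv ht]
      have := hJ.nonneg 0 le_rfl
      linarith
  exact h.mono (by simp)

theorem IsCreepCompliance.laplace_deriv {J σ ε : ℝ → ℝ}
    (hJ : IsCreepCompliance J σ ε) {s : ℂ} (hs : 0 < s.re) (hc : LaplaceConvergent J s) :
    J 0 + laplace (deriv J) s = s * laplace J s := by
  have hs0 : s ≠ 0 := fun h => by simp [h] at hs
  have heq : J =ᵐ[volume.restrict (Ioi 0)] fun t => J 0 * kern 1 t + rl 1 (deriv J) t := by
    filter_upwards [ae_restrict_mem measurableSet_Ioi] with t ht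
    rw [hJ.rl_one_deriv ht, kern_one]; ring
  have hd := hJ.laplaceConvergent_deriv hs hc
  rw [laplace_congr heq s, laplace_add ((transformable_kern one_pos s hs).const_mul _)
    (hd.rl zero_le_one hs), laplace_const_mul, laplace_kern one_pos hs,
    laplace_rl zero_le_one hs hd]
  simp only [Complex.ofReal_one, Complex.cpow_neg_one]
  field_simp

theorem IsCreepCompliance.laplace_strain {J σ ε : ℝ → ℝ}
    (hJ : IsCreepCompliance J σ ε) {s : ℂ} (hs : 0 < s.re) (hc : LaplaceConvergent J s)
    (hσ : LaplaceConvergent σ s) : laplace ε s = s * laplace J s * laplace σ s := by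
  have hd := hJ.laplaceConvergent_deriv hs hc
  have heq : ε =ᵐ[volume.restrict (Ioi 0)] fun t => J 0 * σ t + conv (deriv J) σ t := by
    filter_upwards [ae_restrict_mem measurableSet_Ioi] with t ht
    exact hJ.strain t (le_of_lt ht)
  rw [laplace_congr heq s, laplace_add (hσ.const_mul _) (hd.conv hσ), laplace_const_mul,
    laplace_conv hd hσ, ← hJ.laplace_deriv hs hc]
  ring

/-- Zeros of an analytic function are isolated unless it vanishes identically, and then σ would
vanish almost everywhere, hence everywhere on [0, ∞) by continuity. -/
theorem eventually_laplace_ne_zero {σ : ℝ → ℝ} (hσ : Transformable σ)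
    (hc : ContinuousOn σ (Ici 0)) (hne : ∃ t, 0 ≤ t ∧ σ t ≠ 0) {s : ℂ} (hs : 0 < s.re) :
    ∀ᶠ δ : ℝ in 𝓝[>] 0, laplace σ (s + δ) ≠ 0 := by
  have hopen : IsOpen {s : ℂ | 0 < s.re} := isOpen_lt continuous_const Complex.continuous_re
  have hconv : Convex ℝ {s : ℂ | 0 < s.re} := convex_halfSpace_re_gt 0
  have han := hσ.differentiableOn_laplace.analyticOnNhd hopen
  have ht : Tendsto (fun δ : ℝ => s + (δ : ℂ)) (𝓝[>] 0) (𝓝[≠] s) := by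
    refine tendsto_nhdsWithin_iff.2 ⟨?_, ?_⟩
    · have : Continuous fun δ : ℝ => s + (δ : ℂ) := by fun_prop
      have h := this.tendsto 0
      simp only [Complex.ofReal_zero, add_zero] at h
      exact h.mono_left nhdsWithin_le_nhds
    · filter_upwards [self_mem_nhdsWithin] with δ hδ
      have : δ ≠ 0 := ne_of_gt hδ
      simpa using this
  rcases (han s hs).eventually_eq_zero_or_eventually_ne_zero with h | h
  · exfalso
    have hz := han.eqOn_zero_of_preconnected_of_eventuallyEq_zero hconv.isPreconnected hs h
    have h0 : σ =ᵐ[volume.restrict (Ioi 0)] 0 :=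
      ae_eq_zero_of_laplace_eq_zero (x := 1) (hσ _ (by simp)) fun z hz1 =>
        hz (show 0 < z.re by rw [hz1]; exact one_pos)
    obtain ⟨t, ht0, hσt⟩ := hne
    have h1 : σ =ᵐ[volume.restrict (Icc 0 (t + 1))] 0 := by
      rw [restrict_Ioi_eq_restrict_Ici] at h0
      exact ae_restrict_of_ae_restrict_of_subset Icc_subset_Ici_self h0
    have h2 := Measure.eqOn_Icc_of_ae_eq volume (by linarith : (0 : ℝ) ≠ t + 1) h1
      (hc.mono Icc_subset_Ici_self) continuousOn_const
    exact hσt (h2 ⟨ht0, by linarith⟩)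
  · exact ht.eventually h

/-- Since σ̃ may vanish at s, the division takes place at s + δ for small δ > 0. The limit is taken
from the right only, because s may lie on the boundary of the convergence half-plane of J. -/
theorem IsCreepCompliance.laplace_eq {ν : ℝ} (hν : -1 < ν) {J σ ε : ℝ → ℝ}
    (hJ : IsCreepCompliance J σ ε) (hσ : Transformable σ) (hc : ContinuousOn σ (Ici 0))
    (hne : ∃ t, 0 ≤ t ∧ σ t ≠ 0) (hL : LaplaceEquation ν σ ε) {s : ℂ} (hs : 0 < s.re)
    (hJs : LaplaceConvergent J s) :
    s * laplace J s = besselISqrt ν s / besselISqrt (ν + 2) s := by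
  have hne2 := besselISqrt_ne_zero (μ := ν + 2) (by linarith) hs
  have ht : Tendsto (fun δ : ℝ => s + (δ : ℂ)) (𝓝[>] 0) (𝓝 s) := by
    have : Continuous fun δ : ℝ => s + (δ : ℂ) := by fun_prop
    have h := this.tendsto 0
    simp only [Complex.ofReal_zero, add_zero] at h
    exact h.mono_left nhdsWithin_le_nhds
  have l1 : Tendsto (fun δ : ℝ => besselISqrt (ν + 2) (s + δ) * ((s + δ) * laplace J (s + δ)))
      (𝓝[>] 0) (𝓝 (besselISqrt (ν + 2) s * (s * laplace J s))) :=
    ((continuousAt_besselISqrt (by linarith) hs).tendsto.comp ht).mul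
      (ht.mul hJs.tendsto_add_real)
  have l2 : Tendsto (fun δ : ℝ => besselISqrt ν (s + δ)) (𝓝[>] 0) (𝓝 (besselISqrt ν s)) :=
    (continuousAt_besselISqrt hν hs).tendsto.comp ht
  have heq : ∀ᶠ δ : ℝ in 𝓝[>] 0, besselISqrt ν (s + δ) =
      besselISqrt (ν + 2) (s + δ) * ((s + δ) * laplace J (s + δ)) := by
    filter_upwards [eventually_laplace_ne_zero hσ hc hne hs, self_mem_nhdsWithin] with δ hδ hpos
    have hδ0 : 0 < δ := hpos
    have hre : 0 < (s + (δ : ℂ)).re := by simp; linarith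
    have hJ' : LaplaceConvergent J (s + δ) := hJs.mono (by simpa using hδ0.le)
    have h1 := hL (s + δ) hre
    rw [hJ.laplace_strain hre hJ' (hσ _ hre), ← mul_assoc] at h1
    exact mul_right_cancel₀ hδ h1
  have := tendsto_nhds_unique (l2.congr' heq) l1
  rw [eq_div_iff hne2, this]; ring

/-! ### The operators of the Bessel model -/

theorem caputo_eq_rl {α θ : ℝ} {m : ℕ} (hm : ⌈α⌉₊ = m) (hθ : (m : ℝ) - α = θ) (f : ℝ → ℝ) (t : ℝ) :
    caputo α f t = rl θ (D m f) t := by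
  unfold caputo rl
  rw [hm]
  by_cases h : θ = 0
  · rw [if_pos h, if_pos (by linarith)]
  · rw [if_neg h, if_neg (fun h' => h (by linarith)), hθ, conv, ← intervalIntegral.integral_const_mul]
    simp only [kern, mul_assoc]

/-- The integer `⌈ν/2⌉`, as a natural number. -/
noncomputable def ceilHalf (ν : ℝ) : ℕ := ⌈ν / 2⌉.toNat

/-- The order `⌈ν/2⌉ - ν/2` of the integral in the Caputo derivatives. -/
noncomputable def fracHalf (ν : ℝ) : ℝ := ceilHalf ν - ν / 2

section
variable {ν : ℝ}

theorem ceilHalf_cast (hν : -1 < ν) : (ceilHalf ν : ℤ) = ⌈ν / 2⌉ :=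
  Int.toNat_of_nonneg (Int.ceil_nonneg_of_neg_one_lt (by linarith))

theorem ceilHalf_cast_real (hν : -1 < ν) : (ceilHalf ν : ℝ) = (⌈ν / 2⌉ : ℝ) := by
  rw [← ceilHalf_cast hν, Int.cast_natCast]

theorem fracHalf_nonneg (hν : -1 < ν) : 0 ≤ fracHalf ν := by
  rw [fracHalf, ceilHalf_cast_real hν]
  linarith [Int.le_ceil (ν / 2)]

theorem fracHalf_le_one (hν : -1 < ν) : fracHalf ν ≤ 1 := by
  rw [fracHalf, ceilHalf_cast_real hν]
  linarith [Int.ceil_lt_add_one (ν / 2)]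

theorem natCeil_natCast_add (hν : -1 < ν) (k : ℕ) : ⌈(k : ℝ) + ν / 2⌉₊ = ceilHalf ν + k := by
  rw [← Int.ceil_toNat, Int.ceil_natCast_add, ← ceilHalf_cast hν]
  omega

/-- The starting order has the shape d + b with b = `ceilHalf ν`, as required by the lemmas on
`ord`; d is 0 for the stress and 1 for the strain. -/
theorem truncP_eq (hν : -1 < ν) (f : ℝ → ℝ) :
    truncP ν f = frac (p ν) (fracHalf ν) (0 + ceilHalf ν) fun n => D n f := by
  ext N t
  refine Finset.sum_congr rfl fun k _ => ?_
  rw [caputo_eq_rl (natCeil_natCast_add hν k) (θ := fracHalf ν) (by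
    rw [fracHalf]; push_cast; ring), zero_add]

theorem truncQ_eq (hν : -1 < ν) (f : ℝ → ℝ) :
    truncQ ν f = frac (q ν) (fracHalf ν) (1 + ceilHalf ν) fun n => D n f := by
  ext N t
  refine Finset.sum_congr rfl fun k _ => ?_
  have h := natCeil_natCast_add hν (k + 1)
  push_cast at h
  rw [caputo_eq_rl h (θ := fracHalf ν) (by rw [fracHalf]; push_cast; ring),
    show ceilHalf ν + (k + 1) = 1 + ceilHalf ν + k by ring]

theorem initP_eq (hν : -1 < ν) (f : ℝ → ℝ) :
    initP ν f = initialSum (p ν) (0 + ceilHalf ν) fun n => D n f := by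
  ext k N
  rw [initP, initialSum, ← ceilHalf_cast hν]
  refine Finset.sum_congr (Finset.filter_congr fun n _ => by omega) fun n hn => ?_
  congr 2
  omega

theorem initQ_eq (hν : -1 < ν) (f : ℝ → ℝ) :
    initQ ν f = initialSum (q ν) (1 + ceilHalf ν) fun n => D n f := by
  ext k N
  rw [initQ, initialSum, ← ceilHalf_cast hν]
  refine Finset.sum_congr (Finset.filter_congr fun n _ => by omega) fun n hn => ?_
  congr 2
  omega

theorem truncPbar_eq (f : ℝ → ℝ) (N : ℕ) (t : ℝ) :
    truncPbar ν f N t = 4 ^ (ν / 2) * ord (p ν) 0 (fun n => D n f) N 0 t := by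
  rw [truncPbar, ord, Finset.mul_sum]
  refine Finset.sum_congr rfl fun k _ => ?_
  have h4 : (0 : ℝ) < 4 ^ (ν / 2) := by positivity
  rw [p, Real.rpow_add (by norm_num), Real.rpow_natCast, add_zero, zero_add]
  field_simp

theorem truncQbar_eq (f : ℝ → ℝ) (N : ℕ) (t : ℝ) :
    truncQbar ν f N t = 4 ^ (ν / 2) * ord (q ν) 1 (fun n => D n f) N 0 t := by
  rw [truncQbar, ord, Finset.mul_sum]
  refine Finset.sum_congr rfl fun k _ => ?_
  have h4 : (0 : ℝ) < 4 ^ (ν / 2) := by positivity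
  have e : (k : ℝ) + 1 + ν / 2 = ((k + 1 : ℕ) : ℝ) + ν / 2 := by push_cast; ring
  rw [q, e, Real.rpow_add (by norm_num), Real.rpow_natCast, add_zero, add_comm 1 k]
  field_simp

theorem fracDominated_P (hν : -1 < ν) {σ : ℝ → ℝ} (hσ : IsHistory σ)
    (hdom : DominatedL1 (truncP ν σ)) : ∃ α,
    FracDominated ν (p ν) (fracHalf ν) (0 + ceilHalf ν) (fun n => D n σ) α := by
  obtain ⟨α, hα, hb⟩ := hdom
  rw [truncP_eq hν] at hb
  refine ⟨α, besselCoeff_p hν, fracHalf_nonneg hν, fracHalf_le_one hν, hσ.isTower,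
    hα.mono_set Ioi_subset_Ici_self, fun N hN => ?_⟩
  rw [restrict_Ioi_eq_restrict_Ici]
  exact hb N hN

theorem fracDominated_Q (hν : -1 < ν) {ε : ℝ → ℝ} (hε : IsHistory ε)
    (hdom : DominatedL1 (truncQ ν ε)) : ∃ α,
    FracDominated (ν + 2) (q ν) (fracHalf ν) (1 + ceilHalf ν) (fun n => D n ε) α := by
  obtain ⟨α, hα, hb⟩ := hdom
  rw [truncQ_eq hν] at hb
  refine ⟨α, q_eq_p ν ▸ besselCoeff_p (by linarith), fracHalf_nonneg hν, fracHalf_le_one hν,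
    hε.isTower, hα.mono_set Ioi_subset_Ici_self, fun N hN => ?_⟩
  rw [restrict_Ioi_eq_restrict_Ici]
  exact hb N hN

theorem AEConvergent.tendsto_limitOp {F : ℕ → ℝ → ℝ} (h : AEConvergent F) :
    ∀ᵐ t ∂volume.restrict (Ioi 0), Tendsto (fun N => F N t) atTop (𝓝 (limitOp F t)) := by
  rw [restrict_Ioi_eq_restrict_Ici]
  filter_upwards [h] with t ht using tendsto_nhds_limUnder ht

theorem D_zero (f : ℝ → ℝ) : D 0 f = f := by
  ext t
  simp [D]

theorem fractionalEquation_iff (σ ε : ℝ → ℝ) : FractionalEquation ν σ ε ↔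
    limitOp (truncP ν σ) =ᵐ[volume.restrict (Ioi 0)] limitOp (truncQ ν ε) := by
  rw [restrict_Ioi_eq_restrict_Ici]
  rfl

theorem exists_initial_limit (hν : -1 < ν) {σ ε : ℝ → ℝ} (h : InitialCondition ν σ ε) :
    ∃ l : ℕ → ℝ, (∀ i, Tendsto (initialSum (p ν) (0 + ceilHalf ν) (fun n => D n σ) (i + 1)) atTop
      (𝓝 (l i))) ∧ ∀ i, Tendsto (initialSum (q ν) (1 + ceilHalf ν) (fun n => D n ε) (i + 1)) atTop
      (𝓝 (l i)) := by
  have : ∀ i : ℕ, ∃ l : ℝ, Tendsto (initP ν σ (i + 1)) atTop (𝓝 l) ∧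
      Tendsto (initQ ν ε (i + 1)) atTop (𝓝 l) := fun i => h (i + 1) (by omega)
  choose l hl using this
  rw [initP_eq hν, initQ_eq hν] at hl
  exact ⟨l, fun i => (hl i).1, fun i => (hl i).2⟩

theorem cpow_neg_fracHalf_mul {s : ℂ} (hs : s ≠ 0) :
    s ^ (-fracHalf ν : ℂ) * s ^ ceilHalf ν = s ^ ((ν / 2 : ℝ) : ℂ) := by
  rw [← Complex.cpow_natCast, ← Complex.cpow_add _ _ hs, fracHalf]
  congr 1; push_cast; ring

/-! ### Equivalence of the fractional, Laplace and ordinary equations -/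

/-- The hypotheses on the stress and the strain: dominated convergence of the fractional operators
to `G` and `H`, and convergence of the initial data to the same limits `l`. -/
structure BesselData (ν : ℝ) (σ ε α β : ℝ → ℝ) (l : ℕ → ℝ) (G H : ℝ → ℝ) : Prop where
  hP : FracDominated ν (p ν) (fracHalf ν) (0 + ceilHalf ν) (fun n => D n σ) α
  hQ : FracDominated (ν + 2) (q ν) (fracHalf ν) (1 + ceilHalf ν) (fun n => D n ε) β
  hlP : ∀ i, Tendsto (initialSum (p ν) (0 + ceilHalf ν) (fun n => D n σ) (i + 1)) atTop (𝓝 (l i))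
  hlQ : ∀ i, Tendsto (initialSum (q ν) (1 + ceilHalf ν) (fun n => D n ε) (i + 1)) atTop (𝓝 (l i))
  hG : ∀ᵐ t ∂volume.restrict (Ioi 0), Tendsto (fun N => frac (p ν) (fracHalf ν)
    (0 + ceilHalf ν) (fun n => D n σ) N t) atTop (𝓝 (G t))
  hH : ∀ᵐ t ∂volume.restrict (Ioi 0), Tendsto (fun N => frac (q ν) (fracHalf ν)
    (1 + ceilHalf ν) (fun n => D n ε) N t) atTop (𝓝 (H t))

/-- In the difference of the two limit transforms the common series Σ s^i l_i cancels. The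
additional power of s on the strain side turns s^(ν/2) into the prefactor s^((ν+2)/2) of the second
Bessel function. -/
theorem fractional_iff_laplace {σ ε α β : ℝ → ℝ} {l : ℕ → ℝ} {G H : ℝ → ℝ}
    (B : BesselData ν σ ε α β l G H) :
    G =ᵐ[volume.restrict (Ioi 0)] H ↔ LaplaceEquation ν σ ε := by
  have key : ∀ s : ℂ, 0 < s.re → laplace G s - laplace H s =
      besselISqrt ν s * laplace σ s - besselISqrt (ν + 2) s * laplace ε s := fun s hs => by
    have hs0 : s ≠ 0 := fun h => by simp [h] at hs
    rw [B.hP.laplace_limit B.hlP B.hG hs, B.hQ.laplace_limit B.hlQ B.hH hs, besselISqrt_eq _ hs0,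
      besselISqrt_eq _ hs0, ← q_eq_p, D_zero, D_zero, zero_add, pow_add, pow_one,
      show (((ν + 2) / 2 : ℝ) : ℂ) = ((ν / 2 : ℝ) : ℂ) + 1 by push_cast; ring,
      Complex.cpow_add _ _ hs0, Complex.cpow_one, ← cpow_neg_fracHalf_mul hs0]
    ring
  constructor
  · intro h s hs
    have := key s hs
    rw [laplace_congr h s, sub_self] at this
    exact (sub_eq_zero.1 this.symm)
  · intro h
    refine ae_eq_of_laplace_eq (IntegrableOn.transformable (B.hP.integrableOn_limit B.hG))
      (IntegrableOn.transformable (B.hQ.integrableOn_limit B.hH)) fun s hs => ?_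
    have := key s hs
    rw [h s hs, sub_self] at this
    exact sub_eq_zero.1 this

theorem one_add_sub_fracHalf (hν : -1 < ν) : 0 ≤ 1 + (ceilHalf ν : ℝ) - fracHalf ν := by
  rw [fracHalf]; linarith

theorem weak_iff (hν : -1 < ν) {σ ε α β : ℝ → ℝ} {l : ℕ → ℝ} {G H : ℝ → ℝ}
    (B : BesselData ν σ ε α β l G H) :
    G =ᵐ[volume.restrict (Ioi 0)] H ↔ WeakOrdinaryEquation ν σ ε := by
  have h4 : (0 : ℝ) < 4 ^ (ν / 2) := by positivity
  have hGt := IntegrableOn.transformable (B.hP.integrableOn_limit B.hG)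
  have hHt := IntegrableOn.transformable (B.hQ.integrableOn_limit B.hH)
  have h1 := one_add_sub_fracHalf hν
  rw [← ordLimit_ae_eq_iff h1 l hGt hHt]
  have eP : ∀ (w : ℝ → ℝ) N, ∫ t in Ioi (0 : ℝ), truncPbar ν σ N t * w t =
      4 ^ (ν / 2) * ∫ t in Ioi (0 : ℝ), ord (p ν) 0 (fun n => D n σ) N 0 t * w t := fun w N => by
    rw [← integral_const_mul]
    simp only [truncPbar_eq, mul_assoc]
  have eQ : ∀ (w : ℝ → ℝ) N, ∫ t in Ioi (0 : ℝ), truncQbar ν ε N t * w t =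
      4 ^ (ν / 2) * ∫ t in Ioi (0 : ℝ), ord (q ν) 1 (fun n => D n ε) N 0 t * w t := fun w N => by
    rw [← integral_const_mul]
    simp only [truncQbar_eq, mul_assoc]
  constructor
  · intro h w hw hs
    have tP := (B.hP.tendsto_weak B.hlP B.hG hw hs).const_mul (4 ^ (ν / 2))
    have tQ := (B.hQ.tendsto_weak B.hlQ B.hH hw hs).const_mul (4 ^ (ν / 2))
    have heq : ∫ t in Ioi (0 : ℝ), ordLimit (fracHalf ν) (ceilHalf ν) l H 1 t * deriv w t =
        ∫ t in Ioi (0 : ℝ), ordLimit (fracHalf ν) (ceilHalf ν) l G 1 t * deriv w t := by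
      refine integral_congr_ae ?_
      filter_upwards [h] with t ht
      rw [ht]
    rw [heq] at tQ
    simp only [eP, eQ]
    exact ⟨_, tP, tQ⟩
  · intro h
    refine ae_eq_of_forall_integral_deriv (transformable_ordLimit zero_le_one h1 l hGt).locInt
      (transformable_ordLimit zero_le_one h1 l hHt).locInt fun w hw hs => ?_
    obtain ⟨m, mP, mQ⟩ := h w hw hs
    simp only [eP] at mP
    simp only [eQ] at mQ
    have uP := tendsto_nhds_unique mP ((B.hP.tendsto_weak B.hlP B.hG hw hs).const_mul (4 ^ (ν / 2)))
    have uQ := tendsto_nhds_unique mQ ((B.hQ.tendsto_weak B.hlQ B.hH hw hs).const_mul (4 ^ (ν / 2)))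
    exact neg_injective (mul_left_cancel₀ h4.ne' (uP.symm.trans uQ))

/-- The two pointwise limits are compared through their primitives, which `rl_one_limit` identifies
with `ordLimit` at e = 1. -/
theorem ordinaryEquation_iff (hν : -1 < ν) {σ ε α β : ℝ → ℝ} {l : ℕ → ℝ} {G H : ℝ → ℝ}
    (B : BesselData ν σ ε α β l G H)
    (cP : AEConvergent (truncPbar ν σ)) (cQ : AEConvergent (truncQbar ν ε))
    (dP : DominatedL1loc (truncPbar ν σ)) (dQ : DominatedL1loc (truncQbar ν ε)) :
    G =ᵐ[volume.restrict (Ioi 0)] H ↔ OrdinaryEquation ν σ ε := by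
  set κ : ℝ := 4 ^ (ν / 2) with hκ
  have h4 : 0 < κ := by positivity
  have hGt := IntegrableOn.transformable (B.hP.integrableOn_limit B.hG)
  have hHt := IntegrableOn.transformable (B.hQ.integrableOn_limit B.hH)
  have h1 := one_add_sub_fracHalf hν
  have limit : ∀ (T : ℕ → ℝ → ℝ) (O : ℕ → ℝ → ℝ), (∀ N t, T N t = κ * O N t) → AEConvergent T →
      ∀ᵐ t ∂volume.restrict (Ioi 0), Tendsto (fun N => O N t) atTop (𝓝 (κ⁻¹ * limitOp T t)) := by
    intro T O hTO hT
    filter_upwards [hT.tendsto_limitOp] with t ht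
    refine (ht.const_mul κ⁻¹).congr fun N => ?_
    rw [hTO, inv_mul_cancel_left₀ h4.ne']
  have dom : ∀ (T : ℕ → ℝ → ℝ) (O : ℕ → ℝ → ℝ), (∀ N t, T N t = κ * O N t) → DominatedL1loc T →
      ∃ B, LocInt B ∧ ∀ N ≥ 1, ∀ᵐ t ∂volume.restrict (Ioi 0), |O N t| ≤ B t := by
    rintro T O hTO ⟨B, hB, hb⟩
    refine ⟨fun t => κ⁻¹ * B t, fun R hR =>
      (locInt_of_locallyIntegrableOn hB R hR).const_mul _, fun N hN => ?_⟩
    rw [restrict_Ioi_eq_restrict_Ici]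
    filter_upwards [hb N hN] with t ht
    rw [hTO, abs_mul, abs_of_pos h4] at ht
    rwa [le_inv_mul_iff₀ h4]
  obtain ⟨BP, hBP, bP⟩ := dom _ _ (fun N t => truncPbar_eq σ N t) dP
  obtain ⟨BQ, hBQ, bQ⟩ := dom _ _ (fun N t => truncQbar_eq ε N t) dQ
  have rP := B.hP.rl_one_limit B.hlP B.hG (limit _ _ (fun N t => truncPbar_eq σ N t) cP) hBP bP
  have rQ := B.hQ.rl_one_limit B.hlQ B.hH (limit _ _ (fun N t => truncQbar_eq ε N t) cQ) hBQ bQ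
  have hiff : OrdinaryEquation ν σ ε ↔ (fun t => κ⁻¹ * limitOp (truncPbar ν σ) t)
      =ᵐ[volume.restrict (Ioi 0)] fun t => κ⁻¹ * limitOp (truncQbar ν ε) t := by
    rw [restrict_Ioi_eq_restrict_Ici, OrdinaryEquation]
    refine eventually_congr (Eventually.of_forall fun t => ?_)
    exact (mul_right_inj' (inv_ne_zero h4.ne')).symm
  rw [← ordLimit_ae_eq_iff h1 l hGt hHt, hiff]
  constructor
  · intro h
    exact ae_eq_of_rl_one_ae_eq rP.1 rQ.1
      (EventuallyEq.trans rP.2 (EventuallyEq.trans h rQ.2.symm))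
  · intro h
    exact EventuallyEq.trans rP.2.symm (EventuallyEq.trans (rl_congr_ae_Ioi h) rQ.2)

/-- Here b - θ = ν/2 ≥ 0, so `tendsto_rl_ord` applies with e = 0 and speaks of the ordinary partial
sums themselves. -/
theorem aeConvergent_and_dominated {ρ : ℝ} (hν : 0 ≤ ν) {c l : ℕ → ℝ} {F T : ℕ → ℝ → ℝ} {α G : ℝ → ℝ} {d : ℕ}
    (h : FracDominated ρ c (fracHalf ν) (d + ceilHalf ν) F α)
    (hl : ∀ i, Tendsto (initialSum c (d + ceilHalf ν) F (i + 1)) atTop (𝓝 (l i)))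
    (hG : ∀ᵐ t ∂volume.restrict (Ioi 0), Tendsto (fun N => frac c (fracHalf ν)
      (d + ceilHalf ν) F N t) atTop (𝓝 (G t)))
    (hT : ∀ N t, T N t = 4 ^ (ν / 2) * ord c d F N 0 t) :
    AEConvergent T ∧ DominatedL1loc T := by
  have h4 : (0 : ℝ) < 4 ^ (ν / 2) := by positivity
  obtain ⟨hlim, B, hB, hb⟩ := h.tendsto_rl_ord le_rfl (by rw [fracHalf]; linarith) hl hG
  simp only [rl_zero] at hlim hb
  refine ⟨?_, fun t => 4 ^ (ν / 2) * B t, ?_, fun N hN => ?_⟩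
  · rw [AEConvergent, timeMeasure, ← restrict_Ioi_eq_restrict_Ici]
    filter_upwards [hlim] with t ht
    simp only [hT]
    exact ⟨_, ht.const_mul _⟩
  · exact LocInt.locallyIntegrableOn fun R hR => (hB.locInt R hR).const_mul _
  · rw [timeMeasure, ← restrict_Ioi_eq_restrict_Ici]
    filter_upwards [hb] with t ht
    rw [hT, abs_mul, abs_of_pos h4]
    exact mul_le_mul_of_nonneg_left (ht N hN) h4.le

end

end BesselBody

theorem mainTheorem2 (ν : ℝ) (hν : -1 < ν) (σ ε : ℝ → ℝ)
    (hσ : BesselBody.IsHistory σ) (hε : BesselBody.IsHistory ε)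
    (hPconv : BesselBody.AEConvergent (BesselBody.truncP ν σ))
    (hQconv : BesselBody.AEConvergent (BesselBody.truncQ ν ε))
    (hPdom : BesselBody.DominatedL1 (BesselBody.truncP ν σ))
    (hQdom : BesselBody.DominatedL1 (BesselBody.truncQ ν ε))
    (hinit : BesselBody.InitialCondition ν σ ε) :
    -- the Laplace transforms of stress and strain exist for `Re s > 0`
    (∀ s : ℂ, 0 < s.re →
      BesselBody.LaplaceConvergent σ s ∧ BesselBody.LaplaceConvergent ε s) ∧
    -- in the Laplace domain the fractional equation reduces to the equation without initial data
    (BesselBody.FractionalEquation ν σ ε ↔ BesselBody.LaplaceEquation ν σ ε) ∧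
    -- the creep compliance in the Laplace domain
    (∀ s : ℂ, 0 < s.re → BesselBody.besselISqrt (ν + 2) s ≠ 0) ∧
    (BesselBody.FractionalEquation ν σ ε → (∃ t, 0 ≤ t ∧ σ t ≠ 0) →
      ∀ J : ℝ → ℝ, BesselBody.IsCreepCompliance J σ ε →
        ∀ s : ℂ, 0 < s.re → BesselBody.LaplaceConvergent J s →
          s * BesselBody.laplace J s =
            BesselBody.besselISqrt ν s / BesselBody.besselISqrt (ν + 2) s) ∧
    -- the ordinary equation, in the sense of distributions
    (BesselBody.LaplaceEquation ν σ ε ↔ BesselBody.WeakOrdinaryEquation ν σ ε) ∧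
    -- the ordinary equation, pointwise almost everywhere
    (0 ≤ ν → BesselBody.AEConvergent (BesselBody.truncPbar ν σ) ∧
      BesselBody.AEConvergent (BesselBody.truncQbar ν ε) ∧
      (BesselBody.LaplaceEquation ν σ ε ↔ BesselBody.OrdinaryEquation ν σ ε)) ∧
    (BesselBody.AEConvergent (BesselBody.truncPbar ν σ) →
      BesselBody.AEConvergent (BesselBody.truncQbar ν ε) →
      BesselBody.DominatedL1loc (BesselBody.truncPbar ν σ) →
      BesselBody.DominatedL1loc (BesselBody.truncQbar ν ε) →
      (BesselBody.LaplaceEquation ν σ ε ↔ BesselBody.OrdinaryEquation ν σ ε)) := by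
  obtain ⟨α, hP⟩ := BesselBody.fracDominated_P hν hσ hPdom
  obtain ⟨β, hQ⟩ := BesselBody.fracDominated_Q hν hε hQdom
  obtain ⟨l, hlP, hlQ⟩ := BesselBody.exists_initial_limit hν hinit
  have hG := hPconv.tendsto_limitOp
  have hH := hQconv.tendsto_limitOp
  have hfl := BesselBody.fractionalEquation_iff (ν := ν) σ ε
  rw [BesselBody.truncP_eq hν] at hG hfl
  rw [BesselBody.truncQ_eq hν] at hH hfl
  have hB : BesselBody.BesselData ν σ ε α β l _ _ := ⟨hP, hQ, hlP, hlQ, hG, hH⟩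
  have h1 := BesselBody.fractional_iff_laplace hB
  have hσt : BesselBody.Transformable σ := by simpa only [BesselBody.D_zero] using hP.transformable 0
  have hεt : BesselBody.Transformable ε := by simpa only [BesselBody.D_zero] using hQ.transformable 0
  have hσc : ContinuousOn σ (Ici 0) := hσ.smooth.continuousOn
  refine ⟨fun s hs => ⟨hσt s hs, hεt s hs⟩, hfl.trans h1,
    fun s hs => BesselBody.besselISqrt_ne_zero (by linarith) hs,
    fun hF hne J hJ s hs hJs => hJ.laplace_eq hν hσt hσc hne ((hfl.trans h1).1 hF) hs hJs,
    h1.symm.trans (BesselBody.weak_iff hν hB), fun hν0 => ?_,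
    fun cP cQ dP dQ =>
      h1.symm.trans (BesselBody.ordinaryEquation_iff hν hB cP cQ dP dQ)⟩
  obtain ⟨cP, dP⟩ := BesselBody.aeConvergent_and_dominated hν0 hP hlP hG
    fun N t => BesselBody.truncPbar_eq σ N t
  obtain ⟨cQ, dQ⟩ := BesselBody.aeConvergent_and_dominated hν0 hQ hlQ hH
    fun N t => BesselBody.truncQbar_eq ε N t
  exact ⟨cP, cQ,
    h1.symm.trans (BesselBody.ordinaryEquation_iff hν hB cP cQ dP dQ)⟩
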